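/- Let $K$ be a field and $d\ge 0$ an integer. Put $X_K=\operatorname{Spec}K[[x_1,\ldots,x_d]]$ with closed point $P_K$, and $\mathbb{A}^d_K=\operatorname{Spec}K[x_1,\ldots,x_d]$. Let $Y_K$ be an integral scheme and let $f_K\colon Y_K\to X_K$ be a projective morphism (in particular separated and of finite type) which is an isomorphism outside $P_K$, that is, which restricts to an isomorphism $f_K^{-1}(X_K\setminus\{P_K\})\to X_K\setminus\{P_K\}$. Then $f_K$ is descendible: there exist a scheme $\bar Y_K$ and a projective morphism $\bar f_K\colon\bar Y_K\to\mathbb{A}^d_K$ whose base change along the morphism $X_K\to\mathbb{A}^d_K$ induced by the inclusion $K[x_1,\ldots,x_d]\subset K[[x_1,\ldots,x_d]]$ is $f_K$; that is, there is a cartesian square $$\begin{array}{ccc} Y_K & \longrightarrow & \bar Y_K\\ {\scriptstyle f_K}\downarrow & & \downarrow{\scriptstyle \bar f_K}\\ X_K & \longrightarrow & \mathbb{A}^d_K. \end{array}$$ Here a morphism $Y\to S$ is called projective if it factors as a closed immersion $Y\hookrightarrow\mathbb{P}^n_S=S\times\mathbb{P}^n_{\mathbb{Z}}$ for some $n\ge0$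 followed by the projection $\mathbb{P}^n_S\to S$. -/

import Mathlib

open CategoryTheory CategoryTheory.Limits AlgebraicGeometry

universe u

noncomputable section

namespace Descent

/-- Projective `n`-space over the integers: `Proj ℤ[x₀, …, xₙ]` with the grading by total degree. -/
def IntProjectiveSpace (n : ℕ) : Scheme.{u} :=
  letI : GradedAlgebra (MvPolynomial.homogeneousSubmodule (Fin (n + 1)) (ULift.{u} ℤ)) :=
    MvPolynomial.gradedAlgebra
  Proj (MvPolynomial.homogeneousSubmodule (Fin (n + 1)) (ULift.{u} ℤ))

/-- Projective `n`-space `S × ℙⁿ_ℤ` over a scheme `S`. -/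
def ProjectiveSpace (n : ℕ) (S : Scheme.{u}) : Scheme.{u} :=
  pullback (terminal.from S) (terminal.from (IntProjectiveSpace.{u} n))

/-- The structure morphism of projective `n`-space over `S`. -/
def ProjectiveSpace.toBase (n : ℕ) (S : Scheme.{u}) : ProjectiveSpace n S ⟶ S :=
  pullback.fst (terminal.from S) (terminal.from (IntProjectiveSpace.{u} n))

/-- A morphism is projective if it factors as a closed immersion into some projective space
over the target, followed by the structure morphism of that projective space. -/
def IsProjective {Y S : Scheme.{u}} (f : Y ⟶ S) : Prop :=
  ∃ (n : ℕ) (i : Y ⟶ ProjectiveSpace n S),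
    IsClosedImmersion i ∧ i ≫ ProjectiveSpace.toBase n S = f

/-- `Y` is a variety over `S` via `f`: it is integral, and separated and of finite type
over `S`. -/
structure IsVarietyOver {Y S : Scheme.{u}} (f : Y ⟶ S) : Prop where
  isIntegral : IsIntegral Y
  isSeparated : IsSeparated f
  locallyOfFiniteType : LocallyOfFiniteType f
  quasiCompact : QuasiCompact f

/-- Affine space `Spec K[x₁, …, x_d]`. -/
def AffSpace (d : ℕ) (K : Type u) [Field K] : Scheme.{u} :=
  Spec (CommRingCat.of (MvPolynomial (Fin d) K))

/-- The spectrum `Spec K[[x₁, …, x_d]]` of the formal power series ring. -/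
def FormalSpec (d : ℕ) (K : Type u) [Field K] : Scheme.{u} :=
  Spec (CommRingCat.of (MvPowerSeries (Fin d) K))

/-- The morphism `Spec K[[x₁, …, x_d]] ⟶ Spec K[x₁, …, x_d]` given by the inclusion
of polynomials into power series. -/
def FormalSpec.toAffSpace (d : ℕ) (K : Type u) [Field K] : FormalSpec d K ⟶ AffSpace d K :=
  Spec.map (CommRingCat.ofHom
    (MvPolynomial.coeToMvPowerSeries.ringHom (σ := Fin d) (R := K)))

/-- The closed point of `Spec K[[x₁, …, x_d]]`. -/
def FormalSpec.closedPoint (d : ℕ) (K : Type u) [Field K] : FormalSpec d K :=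
  (IsLocalRing.closedPoint (MvPowerSeries (Fin d) K) :
    PrimeSpectrum (MvPowerSeries (Fin d) K))

/-- The complement of the closed point of `Spec K[[x₁, …, x_d]]`. -/
def FormalSpec.puncturedOpen (d : ℕ) (K : Type u) [Field K] : (FormalSpec d K).Opens :=
  ⟨{FormalSpec.closedPoint d K}ᶜ,
    (IsLocalRing.isClosed_singleton_closedPoint (MvPowerSeries (Fin d) K)).isOpen_compl⟩

/-- A morphism `f` to `Spec K[[x₁, …, x_d]]` is descendible if it is the base change, along
`Spec K[[x₁, …, x_d]] ⟶ Spec K[x₁, …, x_d]`, of a projective morphism to affine space. -/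
def IsDescendible {d : ℕ} {K : Type u} [Field K] {Y : Scheme.{u}} (f : Y ⟶ FormalSpec d K) :
    Prop :=
  ∃ (Ybar : Scheme.{u}) (fbar : Ybar ⟶ AffSpace d K) (g : Y ⟶ Ybar),
    IsProjective fbar ∧ IsPullback g f fbar (FormalSpec.toAffSpace d K)

end Descent

end

/-! Write `R` for the power series ring, `A` for the polynomial ring, `F` and `F₀` for their
fraction fields. If `d = 0`, then `A → R` is bijective and nothing has to be descended. Let `d > 0`.

Since `Y` is integral, it is the scheme-theoretic closure in `ℙⁿ_R` of one `F`-point, the lift of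
the generic point of `Spec R`. As `R` is factorial, this point has a primitive coordinate vector `f`
over `R`. Over each non-maximal prime `p`, the isomorphism extends the point to `Spec R_p`, so `f`
is proportional to a vector with an entry outside `p`; primitivity then shows that some `f j` lies
outside `p`. Hence the entries of `f` generate an ideal containing `𝔪ᵏ`
(`exists_maximalIdeal_pow_le_span`).

Truncating `f` in degree `k + 1` therefore changes it by `M f` with `M` a matrix over `𝔪`, and `N =
1 - M` is invertible with `N f = g` polynomial (`exists_isUnit_matrix_mulVec_eq_coe`). The
automorphism of `ℙⁿ_R` given by `N` moves `Y` to the closure of the point `g`.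

Let `Ybar` be the closure in `ℙⁿ_A` of the `F₀`-point `g`. Scheme-theoretic images commute with the
flat base change `A → R`, so the base change of `Ybar` is the closure of `Spec (F₀ ⊗ R)`. Because
`F₀ ⊗ R → F` is injective, this is also the closure of the `F`-point, that is, `Y`
(`exists_isPullback_of_flat`, `exists_isPullback_of_specPoint`). -/

noncomputable section

namespace Descent

/-! ### Power series rings: adic completeness, flatness, factoriality -/

section PowerSeriesAlgebra

open MvPowerSeries

variable {K : Type*} [Field K]

/-- The power series ring is the completion of the polynomial ring at `I = (X)`. As `I` is finitely
generated, the kernel of the map to the `k`-th quotient is generated by `I ^ k`. -/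
lemma sub_truncTotal_mem_pow {σ : Type*} [Finite σ] (k : ℕ) (f : MvPowerSeries σ K) :
    f - (f.truncTotal k : MvPowerSeries σ K) ∈
      (Ideal.span (Set.range X) : Ideal (MvPowerSeries σ K)) ^ k := by
  set I := MvPolynomial.idealOfVars σ K
  set p := f - (f.truncTotal k : MvPowerSeries σ K)
  let e := toAdicCompletionAlgEquiv σ K
  have hp : p.truncTotal k = 0 := by
    ext x
    by_cases hx : x.degree < k
    · rw [coeff_truncTotal _ hx]; simp [p, coeff_truncTotal _ hx]
    · rw [coeff_truncTotal_eq_zero _ (not_lt.mp hx)]; simp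
  have h1 : e p ∈ (I ^ k • ⊤ : Submodule (MvPolynomial σ K)
      (AdicCompletion I (MvPolynomial σ K))) := by
    rw [AdicCompletion.pow_smul_top_eq_ker_eval (MvPolynomial.idealOfVars_fg σ K)]
    rw [LinearMap.mem_ker, AdicCompletion.eval_apply]
    change (toAdicCompletion σ K p).val k = 0
    rw [toAdicCompletion_apply_eq_mk_truncTotal, hp]; simp
  have h3 : p ∈ (I ^ k).map (algebraMap (MvPolynomial σ K) (MvPowerSeries σ K)) := by
    have := Submodule.mem_map_of_mem (f := e.symm.toLinearMap) h1
    rw [Submodule.map_smul''] at this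
    simpa using this
  rw [Ideal.map_pow, Ideal.map_span, ← Set.range_comp] at h3
  have hX : algebraMap (MvPolynomial σ K) (MvPowerSeries σ K) ∘ MvPolynomial.X = X := by
    ext1 i
    simp [algebraMap_apply']
  rwa [hX] at h3

lemma maximalIdeal_mvPowerSeries {σ : Type*} [Finite σ] :
    IsLocalRing.maximalIdeal (MvPowerSeries σ K) = Ideal.span (Set.range X) := by
  apply le_antisymm
  · intro f hf
    have h0 : constantCoeff f = 0 := by
      by_contra h
      exact hf (MvPowerSeries.isUnit_iff_constantCoeff.mpr (isUnit_iff_ne_zero.mpr h))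
    have h1 := sub_truncTotal_mem_pow 1 f
    have h2 : f.truncTotal 1 = 0 := by
      ext x
      by_cases hx : x.degree < 1
      · have : x = 0 := by
          exact (Finsupp.degree_eq_zero_iff x).mp (by omega)
        subst this
        rw [coeff_truncTotal _ hx]; simpa using h0
      · rw [coeff_truncTotal_eq_zero _ (not_lt.mp hx)]; simp
    simpa [h2] using h1
  · rw [Ideal.span_le]
    rintro _ ⟨i, rfl⟩
    change ¬ IsUnit _
    rw [MvPowerSeries.isUnit_iff_constantCoeff]
    simp

instance {σ : Type*} [Finite σ] :
    IsAdicComplete (IsLocalRing.maximalIdeal (MvPowerSeries σ K)) (MvPowerSeries σ K) := by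
  rw [maximalIdeal_mvPowerSeries]; infer_instance

instance {σ : Type*} [Finite σ] : Module.Flat (MvPolynomial σ K) (MvPowerSeries σ K) :=
  Module.Flat.of_linearEquiv (toAdicCompletionAlgEquiv σ K).toLinearEquiv

/-- Supplies the exponents for the change of variables below: substituting `X i ↦ T ^ w i` must not
let the term at `e` cancel. The induction needs the stronger claim that `e` is the unique minimizer
of the weight. -/
lemma exists_weight_of_nonempty (n : ℕ) (S : Set (Fin n → ℕ)) (hS : S.Nonempty) :
    ∃ w : Fin n → ℕ, (∀ i, 0 < w i) ∧ (∀ h : 0 < n, w ⟨0, h⟩ = 1) ∧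
      ∃ e ∈ S, ∀ e' ∈ S, ∑ i, w i * e' i = ∑ i, w i * e i → e' = e := by
  suffices h : ∃ w : Fin n → ℕ, (∀ i, 0 < w i) ∧ (∀ h : 0 < n, w ⟨0, h⟩ = 1) ∧
      ∃ e ∈ S, ∀ e' ∈ S, ∑ i, w i * e' i ≤ ∑ i, w i * e i → e' = e by
    obtain ⟨w, h1, h2, e, he, h⟩ := h
    exact ⟨w, h1, h2, e, he, fun e' he' h' ↦ h e' he' h'.le⟩
  induction n with
  | zero =>
    obtain ⟨e, he⟩ := hS
    exact ⟨fun _ ↦ 1, by simp, by simp, e, he, fun e' _ _ ↦ Subsingleton.elim _ _⟩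
  | succ n ih =>
    classical
    have hk : ∃ k, ∃ e ∈ S, e (Fin.last n) = k := ⟨_, hS.some, hS.some_mem, rfl⟩
    set k := Nat.find hk
    obtain ⟨e₀, he₀, hek⟩ := Nat.find_spec hk
    have hmin : ∀ e ∈ S, k ≤ e (Fin.last n) := fun e he ↦ Nat.find_min' hk ⟨e, he, rfl⟩
    obtain ⟨w, hw, hw0, e, ⟨he, h⟩⟩ :=
      ih {e | Fin.snoc (α := fun _ ↦ ℕ) e k ∈ S} ⟨Fin.init e₀, by
        change Fin.snoc _ (Nat.find hk) ∈ S
        rw [← hek, Fin.snoc_init_self]; exact he₀⟩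
    -- The last weight exceeds the weight of the minimizer on the slice where the last exponent has
    -- its least value `k`, so leaving that slice always costs more. For `n = 0` the empty sum gives
    -- weight `1`, as required in position `0`.
    refine ⟨Fin.snoc (α := fun _ ↦ ℕ) w (∑ i, w i * e i + 1), ?_, ?_,
      Fin.snoc (α := fun _ ↦ ℕ) e k, he, ?_⟩
    · intro i
      refine Fin.lastCases (by simp) (fun i ↦ by simpa using hw i) i
    · intro _
      rcases Nat.eq_zero_or_pos n with rfl | hn
      · have := Fin.snoc_last (α := fun _ ↦ ℕ) (∑ i, w i * e i + 1) w
        simpa using this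
      · exact (Fin.snoc_castSucc (α := fun _ ↦ ℕ) _ w ⟨0, hn⟩).trans (hw0 hn)
    · intro e' he' hle
      simp only [Fin.sum_univ_castSucc, Fin.snoc_castSucc, Fin.snoc_last] at hle
      have h1 := hmin e' he'
      have h2 : e' (Fin.last n) = k := by
        by_contra hne
        have : k + 1 ≤ e' (Fin.last n) := by omega
        have := Nat.mul_le_mul_left (∑ i, w i * e i + 1) this
        rw [mul_add] at this
        omega
      have h3 : e' = Fin.snoc (α := fun _ ↦ ℕ) (Fin.init e') k := by
        rw [← h2, Fin.snoc_init_self]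
      rw [h2] at hle
      have := h (Fin.init e') (by rw [Set.mem_ofPred_eq, ← h3]; exact he')
        (by simpa [Fin.init] using hle)
      rw [h3, this]

lemma coeff_single_prod_X_pow {n : ℕ} (w : Fin (n + 1) → ℕ) (d : Fin (n + 1) →₀ ℕ) (m : ℕ) :
    coeff (Finsupp.single 0 m)
      (d.prod fun s e ↦ ((X 0 : MvPowerSeries (Fin (n + 1)) K) ^ w s) ^ e) =
      if ∑ i, w i * d i = m then 1 else 0 := by
  rw [Finsupp.prod_fintype _ _ (by simp)]
  simp_rw [← pow_mul]
  rw [Finset.prod_pow_eq_pow_sum, coeff_X_pow]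
  simp only [(Finsupp.single_injective _).eq_iff, eq_comm]

/-- Some change of variables makes a given nonzero power series regular in the first variable. -/
lemma exists_algEquiv_coeff_single_ne_zero {n : ℕ} (f : MvPowerSeries (Fin (n + 1)) K)
    (hf : f ≠ 0) : ∃ (σ : MvPowerSeries (Fin (n + 1)) K ≃+* MvPowerSeries (Fin (n + 1)) K) (m : ℕ),
      coeff (Finsupp.single 0 m) (σ f) ≠ 0 := by
  obtain ⟨w, hw, hw0, e, he, hmin⟩ := exists_weight_of_nonempty (n + 1)
    {e | coeff (Finsupp.equivFunOnFinite.symm e) f ≠ 0} (by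
      obtain ⟨e, he⟩ := (MvPowerSeries.ne_zero_iff_exists_coeff_ne_zero f).mp hf
      exact ⟨e, by simpa using he⟩)
  have hw0 : w 0 = 1 := hw0 n.succ_pos
  let b : Fin (n + 1) → MvPowerSeries (Fin (n + 1)) K := fun i ↦ X 0 ^ w i
  let c : Fin (n + 1) → MvPowerSeries (Fin (n + 1)) K := fun i ↦ if i = 0 then X 0 else 0
  -- `a 1` is the change of variables and `a (-1)` its inverse. Setting the variables other than `X
  -- 0` to zero after `a 1` yields `b`, because `w 0 = 1`.
  let a (ε : K) : Fin (n + 1) → MvPowerSeries (Fin (n + 1)) K :=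
    fun i ↦ if i = 0 then X 0 else X i + C ε * X 0 ^ w i
  have ha (ε : K) : HasSubst (a ε) := hasSubst_of_constantCoeff_zero fun i ↦ by
    by_cases hi : i = 0 <;> simp [a, hi, (hw i).ne']
  have hb : HasSubst b := hasSubst_of_constantCoeff_zero fun i ↦ by simp [b, (hw i).ne']
  have hc : HasSubst c := hasSubst_of_constantCoeff_zero fun i ↦ by
    by_cases hi : i = 0 <;> simp [c, hi]
  have hinv (ε δ : K) (h : ε + δ = 0) (g : MvPowerSeries (Fin (n + 1)) K) :
      subst (a δ) (subst (a ε) g) = g := by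
    rw [subst_comp_subst_apply (ha ε) (ha δ)]
    have : (fun i ↦ subst (a δ) (a ε i)) = X := by
      ext1 i
      by_cases hi : i = 0
      · simp [a, hi, subst_X (ha δ)]
      · have hδ : δ = -ε := by linear_combination h
        simp only [a, hi, if_false]
        rw [subst_add (ha δ), subst_mul (ha δ), subst_pow (ha δ), subst_X (ha δ), subst_X (ha δ)]
        have : subst (a δ) (C ε : MvPowerSeries (Fin (n + 1)) K) = C ε := subst_C _
        rw [this]
        simp [a, hi, hδ]
    rw [this, subst_self]; rfl
  let σ : MvPowerSeries (Fin (n + 1)) K ≃+* MvPowerSeries (Fin (n + 1)) K :=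
    RingEquiv.ofRingHom (substAlgHom (R := K) (ha 1)).toRingHom
      (substAlgHom (R := K) (ha (-1))).toRingHom
      (RingHom.ext fun g ↦ by simpa using hinv (-1) 1 (by simp) g)
      (RingHom.ext fun g ↦ by simpa using hinv 1 (-1) (by simp) g)
  have hσ (g) : σ g = subst (a 1) g := by simp [σ]
  have hcb : subst c (σ f) = subst b f := by
    rw [hσ, subst_comp_subst_apply (ha 1) hc]
    congr 1
    ext1 i
    by_cases hi : i = 0
    · simp [a, b, c, hi, subst_X hc, hw0]
    · simp [a, b, c, hi, subst_X hc, subst_add hc, subst_pow hc]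
  -- Only the exponent `e` in the support of `f` has its weight, so the coefficient of `subst b f`
  -- in that degree is the coefficient of `f` at `e`.
  have hbf : subst b f ≠ 0 := by
    intro h0
    apply he
    have h1 := coeff_subst hb f (Finsupp.single 0 (∑ i, w i * e i))
    rw [h0, finsum_eq_single _ (Finsupp.equivFunOnFinite.symm e)] at h1
    · rw [coeff_single_prod_X_pow] at h1
      simpa using h1.symm
    · intro d hd
      rw [coeff_single_prod_X_pow]
      by_cases h2 : ∑ i, w i * d i = ∑ i, w i * e i
      · by_cases h3 : coeff d f = 0
        · simp [h3]
        · refine absurd ?_ hd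
          rw [← hmin d (by simpa using h3) h2]
          simp
      · simp [h2]
  refine ⟨σ, ?_⟩
  by_contra! hall
  apply hbf
  rw [← hcb]
  ext e
  rw [coeff_subst hc, coeff_zero]
  refine finsum_eq_zero_of_forall_eq_zero fun d ↦ ?_
  by_cases hd : ∃ i ≠ 0, d i ≠ 0
  · obtain ⟨i, hi, hdi⟩ := hd
    rw [Finsupp.prod, Finset.prod_eq_zero (i := i) (by simpa using hdi)]
    · simp
    · simp [c, hi, hdi]
  · push Not at hd
    have : d = Finsupp.single 0 (d 0) := by
      ext i
      by_cases hi : i = 0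
      · simp [hi]
      · rw [hd i hi, Finsupp.single_eq_of_ne hi]
    rw [this, hall]; simp

/-- A prime ideal of `A⟦X⟧` containing a series that is nonzero modulo the maximal ideal
contains a prime element, for `A` a complete local factorial domain. -/
lemma exists_prime_mem_of_map_residue_ne_zero {A : Type*} [CommRing A] [IsDomain A]
    [UniqueFactorizationMonoid A] [IsLocalRing A]
    [IsAdicComplete (IsLocalRing.maximalIdeal A) A] (Q : Ideal (PowerSeries A)) [hQ : Q.IsPrime]
    (g : PowerSeries A) (hg : g ∈ Q) (hg0 : g.map (IsLocalRing.residue A) ≠ 0) :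
    ∃ p ∈ Q, Prime p := by
  obtain ⟨W, h, hW⟩ := g.exists_isWeierstrassFactorization hg0
  have hWm := hW.isDistinguishedAt.monic
  have hWQ : (W : PowerSeries A) ∈ Q := by
    rw [hW.eq_mul] at hg
    exact (hQ.mem_or_mem hg).resolve_right fun hh ↦
      hQ.ne_top (Ideal.eq_top_of_isUnit_mem _ hh hW.isUnit)
  let φ : Polynomial A →+* PowerSeries A := Polynomial.coeToPowerSeries.ringHom
  have hQ' : (Q.comap φ).IsPrime := inferInstance
  obtain ⟨w, hwQ, hw, v, hWv⟩ : ∃ w ∈ Q.comap φ, Prime w ∧ w ∣ W := by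
    obtain ⟨s, hs, hsW⟩ := UniqueFactorizationMonoid.exists_prime_factors W hWm.ne_zero
    have h1 : s.prod ∈ Q.comap φ := by
      obtain ⟨u, hu⟩ := hsW.symm
      rw [← hu]
      exact Ideal.mul_mem_right _ _ hWQ
    obtain ⟨w, hws, hw⟩ := (hQ'.multiset_prod_mem_iff_exists_mem s).mp h1
    exact ⟨w, hw, hs w hws, (Multiset.dvd_prod hws).trans hsW.dvd⟩
  have hlc : w.leadingCoeff * v.leadingCoeff = 1 := by
    rw [← Polynomial.leadingCoeff_mul, ← hWv, hWm.leadingCoeff]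
  set w' := Polynomial.C v.leadingCoeff * w with hw'
  have hw'm : w'.Monic := by
    rw [Polynomial.Monic, Polynomial.leadingCoeff_mul, Polynomial.leadingCoeff_C, mul_comm, hlc]
  have hunit : IsUnit (Polynomial.C v.leadingCoeff) :=
    Polynomial.isUnit_C.mpr (IsUnit.of_mul_eq_one_right _ hlc)
  have hw'p : Prime w' := (associated_unit_mul_left w _ hunit).symm.prime hw
  have hw'Q : (w' : PowerSeries A) ∈ Q := (Q.comap φ).mul_mem_left _ hwQ
  -- Modulo the maximal ideal, `w'` is a monic divisor of a power of `X`, hence itself a power of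
  -- `X`.
  have hw'd : w'.IsDistinguishedAt (IsLocalRing.maximalIdeal A) := by
    refine ⟨⟨fun {i} hi ↦ ?_⟩, hw'm⟩
    have h1 : w'.map (IsLocalRing.residue A) ∣ Polynomial.X ^ W.natDegree := by
      refine Dvd.dvd.trans ?_ hW.isDistinguishedAt.map_eq_X_pow.dvd
      refine Polynomial.map_dvd (IsLocalRing.residue A) ⟨Polynomial.C w.leadingCoeff * v, ?_⟩
      rw [hWv, hw']
      have := congrArg Polynomial.C hlc
      simp only [map_mul, map_one] at this
      linear_combination (-w * v) * this
    obtain ⟨k, -, hk⟩ := (dvd_prime_pow Polynomial.prime_X _).mp h1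
    have hk' := Polynomial.eq_of_monic_of_associated (hw'm.map _) (Polynomial.monic_X_pow k) hk
    have hdeg : w'.natDegree = k := by
      rw [← hw'm.natDegree_map (IsLocalRing.residue A), hk', Polynomial.natDegree_X_pow]
    rw [← IsLocalRing.residue_eq_zero_iff, ← Polynomial.coeff_map, hk', Polynomial.coeff_X_pow,
      if_neg (by omega)]
  refine ⟨w', hw'Q, ?_⟩
  have hne : (w' : PowerSeries A) ≠ 0 := by
    simpa using hw'm.ne_zero
  rw [← Ideal.span_singleton_prime hne, ← Ideal.Quotient.isDomain_iff_prime]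
  have : IsDomain (Polynomial A ⧸ Ideal.span {w'}) :=
    (Ideal.Quotient.isDomain_iff_prime _).mpr
      ((Ideal.span_singleton_prime hw'm.ne_zero).mpr hw'p)
  -- Weierstrass division identifies the quotients of `A[X]` and `A⟦X⟧` by a distinguished
  -- polynomial, so primality passes from one to the other.
  exact (Polynomial.IsDistinguishedAt.algEquivQuotient hw'd).symm.toMulEquiv.isDomain _

instance {σ : Type*} : IsDomain (MvPowerSeries σ K) := NoZeroDivisors.to_isDomain _

instance uniqueFactorizationMonoid_mvPowerSeries (n : ℕ) :
    UniqueFactorizationMonoid (MvPowerSeries (Fin n) K) := by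
  induction n with
  | zero =>
    exact (isEmptyEquiv (Fin 0) K).symm.toMulEquiv.uniqueFactorizationMonoid inferInstance
  | succ n ih =>
    -- Kaplansky's criterion: every nonzero prime ideal must contain a prime element. After the
    -- change of variables, Weierstrass preparation in the first variable applies over the ring in
    -- `n` variables, factorial by induction.
    refine UniqueFactorizationMonoid.iff_exists_prime_mem_of_isPrime.mpr fun P hP hPp ↦ ?_
    obtain ⟨f, hfP, hf⟩ := Submodule.exists_mem_ne_zero_of_ne_bot hP
    obtain ⟨σ, m, hm⟩ := exists_algEquiv_coeff_single_ne_zero f hf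
    let θ := σ.trans (MvPowerSeries.finSuccEquiv K n).toRingEquiv
    obtain ⟨p, hp, hpp⟩ := exists_prime_mem_of_map_residue_ne_zero (P.comap θ.symm) (θ f)
      (by simpa using hfP) (by
        intro h0
        have h1 := congrArg (PowerSeries.coeff m) h0
        rw [PowerSeries.coeff_map, map_zero, IsLocalRing.residue_eq_zero_iff] at h1
        apply h1
        rw [MvPowerSeries.isUnit_iff_constantCoeff, isUnit_iff_ne_zero,
          ← MvPowerSeries.coeff_zero_eq_constantCoeff_apply]
        change coeff 0 (PowerSeries.coeff m (MvPowerSeries.finSuccEquiv K n (σ f))) ≠ 0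
        rw [coeff_coeff_finSuccEquiv]
        have hcons : Finsupp.cons m (0 : Fin n →₀ ℕ) = Finsupp.single 0 m := by
          ext i
          refine Fin.cases ?_ (fun i ↦ ?_) i <;> simp
        rwa [hcons])
    exact ⟨θ.symm p, hp, (MulEquiv.prime_iff (p := p) θ.symm.toMulEquiv).mpr hpp⟩

end PowerSeriesAlgebra

/-! ### Primitive vectors and their polynomial approximation -/

lemma exists_prime_dvd_mem {R : Type*} [CommRing R] [UniqueFactorizationMonoid R] (p : Ideal R)
    [hp : p.IsPrime] (a : R) (ha : a ≠ 0) (hap : a ∈ p) :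
    ∃ q ∈ p, Prime q ∧ q ∣ a := by
  obtain ⟨s, hs, hsa⟩ := UniqueFactorizationMonoid.exists_prime_factors a ha
  have h1 : s.prod ∈ p := by
    obtain ⟨u, hu⟩ := hsa.symm
    rw [← hu]
    exact Ideal.mul_mem_right _ _ hap
  obtain ⟨q, hqs, hq⟩ := (hp.multiset_prod_mem_iff_exists_mem s).mp h1
  exact ⟨q, hq, hs q hqs, (Multiset.dvd_prod hqs).trans hsa.dvd⟩

section PrimitiveVectors

variable {R : Type*} [CommRing R] [IsDomain R] [UniqueFactorizationMonoid R]

lemma exists_primitive_multiple {F : Type*} [Field F] [Algebra R F] [IsFractionRing R F]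
    {ι : Type*} [Finite ι] (v : ι → F) (hv : v ≠ 0) :
    ∃ (c : F) (f : ι → R), c ≠ 0 ∧ (∀ j, v j = c * algebraMap R F (f j)) ∧
      ∀ q : R, Prime q → ¬ ∀ j, q ∣ f j := by
  classical
  cases nonempty_fintype ι
  obtain ⟨b, hb⟩ := IsLocalization.exist_integer_multiples_of_finite (nonZeroDivisors R) v
  choose w hw using hb
  let _ : StrongNormalizationMonoid R := UniqueFactorizationMonoid.strongNormalizationMonoid
  let _ := UniqueFactorizationMonoid.toNormalizedGCDMonoid R
  obtain ⟨j₀, hj₀⟩ : ∃ j, v j ≠ 0 := by simpa [funext_iff] using hv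
  obtain ⟨f, hf, hf1⟩ := Finset.extract_gcd w (s := Finset.univ) ⟨j₀, Finset.mem_univ _⟩
  have hb0 : algebraMap R F b ≠ 0 := IsFractionRing.to_map_ne_zero_of_mem_nonZeroDivisors b.2
  have key (j) : v j = algebraMap R F (Finset.univ.gcd w) / algebraMap R F b *
      algebraMap R F (f j) := by
    have h1 := hw j
    rw [hf j (Finset.mem_univ _), map_mul, Algebra.smul_def] at h1
    field_simp
    linear_combination -h1
  refine ⟨_, f, ?_, key, fun q hq h ↦ ?_⟩
  · intro h0
    exact hj₀ (by rw [key, h0, zero_mul])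
  · exact hq.not_isUnit (isUnit_of_dvd_one (hf1 ▸ Finset.dvd_gcd fun j _ ↦ h j))

/-- If a primitive vector is locally proportional to a unimodular one away from the closed point,
then its entries generate an ideal that contains a power of the maximal ideal. -/
lemma exists_maximalIdeal_pow_le_span [IsLocalRing R] [IsNoetherianRing R] {ι : Type*}
    (f : ι → R) (hf0 : f ≠ 0) (hf : ∀ q : R, Prime q → ¬ ∀ j, q ∣ f j)
    (h : ∀ p : Ideal R, p.IsPrime → p ≠ IsLocalRing.maximalIdeal R →
      ∃ (i : ι) (a : ι → R), a i ∉ p ∧ ∀ j, a j * f i = a i * f j) :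
    ∃ k, IsLocalRing.maximalIdeal R ^ k ≤ Ideal.span (Set.range f) := by
  refine Ideal.exists_pow_le_of_le_radical_of_fg ?_ (IsNoetherian.noetherian _)
  rw [Ideal.radical_eq_sInf]
  refine le_sInf fun p ⟨hp, hpp⟩ ↦ ?_
  by_contra hm
  have hne : p ≠ IsLocalRing.maximalIdeal R := fun h ↦ hm h.ge
  obtain ⟨i, a, hai, ha⟩ := h p hpp hne
  have hfi : f i ∈ p := hp (Ideal.subset_span ⟨i, rfl⟩)
  have ha0 : a i ≠ 0 := fun h0 ↦ hai (h0 ▸ p.zero_mem)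
  have hfi0 : f i ≠ 0 := by
    intro h0
    apply hf0
    ext j
    have := ha j
    rw [h0, mul_zero, eq_comm, mul_eq_zero] at this
    exact this.resolve_left ha0
  obtain ⟨q, hqp, hq, hqf⟩ := exists_prime_dvd_mem p (f i) hfi0 hfi
  refine hf q hq fun j ↦ ?_
  have : q ∣ a i * f j := ha j ▸ hqf.mul_left _
  refine (hq.dvd_or_dvd this).resolve_left fun hqa ↦ hai ?_
  exact Ideal.mem_of_dvd _ hqa hqp

end PrimitiveVectors

/-- Truncation at `k + 1`, one more than the given exponent, leaves an error in `𝔪 · 𝔪ᵏ`, hence in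
`𝔪` times the ideal of the entries. The error is thus `M f` with `M` over `𝔪`, and `1 - M` is the
identity modulo `𝔪`. -/
lemma exists_isUnit_matrix_mulVec_eq_coe {K : Type*} [Field K] {d n k : ℕ}
    (f : Fin n → MvPowerSeries (Fin d) K)
    (hf : IsLocalRing.maximalIdeal (MvPowerSeries (Fin d) K) ^ k ≤ Ideal.span (Set.range f)) :
    ∃ (N : Matrix (Fin n) (Fin n) (MvPowerSeries (Fin d) K)) (g : Fin n → MvPolynomial (Fin d) K),
      IsUnit N ∧ N.mulVec f = fun j ↦ (g j : MvPowerSeries (Fin d) K) := by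
  set m := IsLocalRing.maximalIdeal (MvPowerSeries (Fin d) K)
  have h1 (j) : f j - ((f j).truncTotal (k + 1) : MvPowerSeries (Fin d) K) ∈
      m • Submodule.span (MvPowerSeries (Fin d) K) (Set.range f) := by
    have := sub_truncTotal_mem_pow (k + 1) (f j)
    rw [← maximalIdeal_mvPowerSeries, pow_succ'] at this
    exact Ideal.mul_mono_right hf this
  simp only [Submodule.mem_ideal_smul_span_iff_exists_sum] at h1
  choose M hM hMf using h1
  let M' : Matrix (Fin n) (Fin n) (MvPowerSeries (Fin d) K) := fun i j ↦ M i j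
  refine ⟨1 - M', fun j ↦ (f j).truncTotal (k + 1), ?_, ?_⟩
  · rw [Matrix.isUnit_iff_isUnit_det]
    by_contra hdet
    have h2 : IsLocalRing.residue _ (1 - M').det = 0 :=
      (IsLocalRing.residue_eq_zero_iff _).mpr hdet
    rw [RingHom.map_det] at h2
    have h3 : (IsLocalRing.residue _).mapMatrix (1 - M') = 1 := by
      rw [map_sub, map_one, sub_eq_self]
      ext i j
      exact (IsLocalRing.residue_eq_zero_iff _).mpr (hM i j)
    rw [h3] at h2
    simp at h2
  · ext1 j
    have h2 := hMf j
    rw [Finsupp.sum_fintype _ _ (by simp)] at h2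
    simp only [Matrix.sub_mulVec, Matrix.one_mulVec, Pi.sub_apply]
    have h3 : M'.mulVec f j = ∑ i, M j i • f i := rfl
    rw [h3, h2]
    ring

/-! ### Evaluating degree-zero fractions at a vector -/

section ProjectivePoints

attribute [local instance] MvPolynomial.gradedAlgebra

open HomogeneousLocalization

/-- The grading of `ℤ[x₀, …, xₙ]` by total degree. -/
abbrev intGrading (n : ℕ) :
    ℕ → Submodule (ULift.{u} ℤ) (MvPolynomial (Fin (n + 1)) (ULift.{u} ℤ)) :=
  MvPolynomial.homogeneousSubmodule (Fin (n + 1)) (ULift.{u} ℤ)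

lemma uliftInt_ringHom_ext {B : Type*} [NonAssocRing B] (f g : ULift.{u} ℤ →+* B) : f = g := by
  have := RingHom.ext_int (f.comp (ULift.ringEquiv (R := ℤ)).symm.toRingHom)
    (g.comp (ULift.ringEquiv (R := ℤ)).symm.toRingHom)
  ext x
  exact RingHom.congr_fun this x.down

variable {n : ℕ} {B C : Type*} [CommRing B] [CommRing C]

/-- Evaluation of integral polynomials at a vector. -/
def evalInt (s : Fin (n + 1) → B) : MvPolynomial (Fin (n + 1)) (ULift.{u} ℤ) →+* B :=
  MvPolynomial.eval₂Hom ((Int.castRingHom B).comp (ULift.ringEquiv (R := ℤ)).toRingHom) s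

@[simp] lemma evalInt_X (s : Fin (n + 1) → B) (j) :
    evalInt.{u} s (MvPolynomial.X j) = s j := by simp [evalInt]

lemma eq_evalInt (φ : MvPolynomial (Fin (n + 1)) (ULift.{u} ℤ) →+* B) :
    φ = evalInt fun j ↦ φ (MvPolynomial.X j) :=
  MvPolynomial.ringHom_ext' (uliftInt_ringHom_ext _ _) (by simp)

lemma evalInt_comp (φ : B →+* C) (s : Fin (n + 1) → B) :
    φ.comp (evalInt.{u} s) = evalInt fun j ↦ φ (s j) := by
  rw [eq_evalInt (φ.comp _)]; simp

lemma evalInt_mul_left (u : B) (s : Fin (n + 1) → B) {m : ℕ}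
    {a : MvPolynomial (Fin (n + 1)) (ULift.{u} ℤ)} (ha : a ∈ intGrading n m) :
    evalInt (fun j ↦ u * s j) a = u ^ m * evalInt s a := by
  simp only [evalInt, MvPolynomial.coe_eval₂Hom, MvPolynomial.eval₂_eq', Finset.mul_sum]
  refine Finset.sum_congr rfl fun d hd ↦ ?_
  have h := ha (MvPolynomial.mem_support_iff.mp hd)
  replace h : d.degree = m := by
    rw [Finsupp.degree_eq_weight_one]
    exact h
  rw [Finsupp.degree_eq_sum] at h
  simp only [mul_pow, Finset.prod_mul_distrib, Finset.prod_pow_eq_pow_sum, h]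
  ring

lemma X_mem_intGrading (i : Fin (n + 1)) :
    (MvPolynomial.X i : MvPolynomial (Fin (n + 1)) (ULift.{u} ℤ)) ∈ intGrading n 1 :=
  MvPolynomial.isHomogeneous_X _ _

/-- The ring homomorphism `ℤ[x₀, …, xₙ]_(f) → B` defined by a vector at which `f` is invertible. -/
def awayEval (s : Fin (n + 1) → B) (f : MvPolynomial (Fin (n + 1)) (ULift.{u} ℤ))
    (hf : IsUnit (evalInt s f)) : Away (intGrading n) f →+* B :=
  (Localization.awayLift (evalInt s) f hf).comp (algebraMap _ (Localization.Away f))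

lemma awayEval_mk (s : Fin (n + 1) → B) {f : MvPolynomial (Fin (n + 1)) (ULift.{u} ℤ)}
    (hf : IsUnit (evalInt s f)) {d : ℕ} (hd : f ∈ intGrading n d) (m : ℕ)
    (a : MvPolynomial (Fin (n + 1)) (ULift.{u} ℤ)) (ha : a ∈ intGrading n (m • d)) :
    awayEval s f hf (Away.mk _ hd m a ha) * evalInt s f ^ m = evalInt s a := by
  rw [awayEval, RingHom.comp_apply, HomogeneousLocalization.algebraMap_apply, Away.val_mk,
    Localization.mk_eq_mk', ← map_pow]
  rw [mul_comm]
  exact ((IsLocalization.lift_mk'_spec (M := Submonoid.powers f) (S := Localization.Away f)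
    _ a _ ⟨f ^ m, _⟩).mp rfl).symm

lemma awayEval_comp (φ : B →+* C) (s : Fin (n + 1) → B)
    {f : MvPolynomial (Fin (n + 1)) (ULift.{u} ℤ)} (hf : IsUnit (evalInt s f))
    (hf' : IsUnit (evalInt (fun j ↦ φ (s j)) f)) {d : ℕ} (hd : f ∈ intGrading n d) :
    φ.comp (awayEval s f hf) = awayEval (fun j ↦ φ (s j)) f hf' := by
  ext x
  obtain ⟨m, a, ha, rfl⟩ := Away.mk_surjective _ hd x
  rw [← (hf'.pow m).mul_left_inj, awayEval_mk, ← evalInt_comp, RingHom.comp_apply,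
    RingHom.comp_apply, RingHom.comp_apply, ← map_pow, ← map_mul, awayEval_mk]

lemma awayEval_mul_left (u : B) (s : Fin (n + 1) → B)
    {f : MvPolynomial (Fin (n + 1)) (ULift.{u} ℤ)} (hf : IsUnit (evalInt s f))
    (hf' : IsUnit (evalInt (fun j ↦ u * s j) f)) {d : ℕ} (hd : f ∈ intGrading n d) :
    awayEval (fun j ↦ u * s j) f hf' = awayEval s f hf := by
  ext x
  obtain ⟨m, a, ha, rfl⟩ := Away.mk_surjective _ hd x
  rw [← (hf'.pow m).mul_left_inj, awayEval_mk, evalInt_mul_left u s ha, evalInt_mul_left u s hd,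
    ← awayEval_mk s hf hd m a ha, mul_pow, ← pow_mul, smul_eq_mul, mul_comm m d]
  ring

lemma awayEval_awayMap (s : Fin (n + 1) → B) {f g x : MvPolynomial (Fin (n + 1)) (ULift.{u} ℤ)}
    {e : ℕ} (he : g ∈ intGrading n e) (hx : x = f * g)
    (hf : IsUnit (evalInt s f)) (hfg : IsUnit (evalInt s x)) :
    (awayEval s x hfg).comp (awayMap (intGrading n) he hx) = awayEval s f hf := by
  ext y
  rw [RingHom.comp_apply, awayEval, awayEval, RingHom.comp_apply, RingHom.comp_apply,
    HomogeneousLocalization.algebraMap_apply, HomogeneousLocalization.algebraMap_apply, val_awayMap]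
  rw [← RingHom.comp_apply]
  congr 1
  refine IsLocalization.ringHom_ext (Submonoid.powers f) ?_
  ext a <;> simp [Localization.awayLift]

/-- Dehomogenization: `a / Xᵢᵐ` is `a` evaluated at the fractions `Xⱼ / Xᵢ`. It is checked in the
full localization after multiplying by the unit `Xᵢᵐ`. -/
lemma mk_eq_evalInt (i : Fin (n + 1)) (m : ℕ)
    (a : MvPolynomial (Fin (n + 1)) (ULift.{u} ℤ)) (ha : a ∈ intGrading n (m • 1)) :
    Away.mk (intGrading n) (X_mem_intGrading i) m a ha = evalInt (fun j ↦
      Away.mk (intGrading n) (X_mem_intGrading i) 1 (MvPolynomial.X j) (X_mem_intGrading j)) a := by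
  let X (i : Fin (n + 1)) : MvPolynomial (Fin (n + 1)) (ULift.{u} ℤ) := MvPolynomial.X i
  let c := algebraMap (MvPolynomial (Fin (n + 1)) (ULift.{u} ℤ)) (Localization.Away (X i))
  let v : Away (intGrading n) (X i) →+* Localization.Away (X i) := algebraMap _ _
  have hu : IsUnit (c (X i)) := IsLocalization.Away.algebraMap_isUnit _
  have h2 (m : ℕ) (a ha) : c (X i) ^ m *
      v (Away.mk (intGrading n) (X_mem_intGrading i) m a ha) = c a := by
    simp only [v, c]
    rw [HomogeneousLocalization.algebraMap_apply, Away.val_mk, Localization.mk_eq_mk', ← map_pow]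
    exact IsLocalization.mk'_spec' _ a ⟨X i ^ m, _⟩
  have hv : Function.Injective v := HomogeneousLocalization.val_injective _
  apply hv
  rw [← (hu.pow m).mul_right_inj, h2, ← RingHom.comp_apply, evalInt_comp]
  have h1 := evalInt_mul_left (c (X i)) (fun j ↦ v
      (Away.mk (intGrading n) (X_mem_intGrading i) 1 (X j) (X_mem_intGrading j))) ha
  rw [smul_eq_mul, mul_one] at h1
  refine Eq.trans ?_ h1
  have h3 (j) := h2 1 (X j) (X_mem_intGrading j)
  simp only [pow_one] at h3
  simp only [h3]
  exact RingHom.congr_fun (eq_evalInt _) a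

/-- A homomorphism from a standard chart of projective space is determined by its coordinates. -/
lemma eq_awayEval (i : Fin (n + 1)) (φ : Away (intGrading.{u} n) (MvPolynomial.X i) →+* B) :
    ∃ (s : Fin (n + 1) → B) (hs : s i = 1),
      φ = awayEval s (MvPolynomial.X i) (by simp [hs]) := by
  have h1 : φ (Away.mk (intGrading n) (X_mem_intGrading i) 1 (MvPolynomial.X i)
      (X_mem_intGrading i)) = 1 := by
    convert map_one φ
    apply HomogeneousLocalization.val_injective
    rw [Away.val_mk]
    simp only [pow_one, val_one]
    exact Localization.mk_self ⟨(MvPolynomial.X i : MvPolynomial (Fin (n + 1)) (ULift.{u} ℤ)), _⟩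
  refine ⟨fun j ↦ φ (Away.mk (intGrading n) (X_mem_intGrading i) 1 (MvPolynomial.X j)
    (X_mem_intGrading j)), h1, ?_⟩
  ext x
  obtain ⟨m, a, ha, rfl⟩ := Away.mk_surjective _ (X_mem_intGrading i) x
  have h2 := awayEval_mk (fun j ↦ φ (Away.mk (intGrading n) (X_mem_intGrading i) 1
    (MvPolynomial.X j) (X_mem_intGrading j))) (by simp [h1]) (X_mem_intGrading i) m a ha
  have h3 : ∀ t : B, t = 1 → ∀ x y : B, x * t ^ m = y → x = y := by
    rintro _ rfl x y hxy
    simpa using hxy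
  rw [h3 _ (by simp [h1]) _ _ h2, mk_eq_evalInt, ← RingHom.comp_apply, evalInt_comp]

end ProjectivePoints

/-! ### Morphisms to projective space by homogeneous coordinates -/

section ProjectivePoints

attribute [local instance] MvPolynomial.gradedAlgebra

open HomogeneousLocalization

variable {n : ℕ}

/-- The morphism to `Proj ℤ[x₀, …, xₙ]` defined by a vector of global functions at which the
homogeneous form `f` of positive degree is invertible. -/
def projPoint {Z : Scheme.{u}} (s : Fin (n + 1) → Γ(Z, ⊤))
    {f : MvPolynomial (Fin (n + 1)) (ULift.{u} ℤ)} {d : ℕ} (hd : f ∈ intGrading n d) (h0 : 0 < d)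
    (hf : IsUnit (evalInt s f)) : Z ⟶ Proj (intGrading.{u} n) :=
  Z.toSpecΓ ≫ Spec.map (CommRingCat.ofHom (awayEval s f hf)) ≫
    Proj.awayι (intGrading n) f hd h0

lemma projPoint_mul {Z : Scheme.{u}} (s : Fin (n + 1) → Γ(Z, ⊤))
    {f g x : MvPolynomial (Fin (n + 1)) (ULift.{u} ℤ)} {d e : ℕ} (hd : f ∈ intGrading n d)
    (h0 : 0 < d) (hf : IsUnit (evalInt s f)) (he : g ∈ intGrading n e) (hx : x = f * g)
    {d' : ℕ} (hd' : x ∈ intGrading n d') (hdd' : d + e = d') (h0' : 0 < d')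
    (hfg : IsUnit (evalInt s x)) :
    projPoint s hd' h0' hfg = projPoint s hd h0 hf := by
  subst hdd'
  rw [projPoint, projPoint, ← Proj.SpecMap_awayMap_awayι (intGrading n) hd h0 he hx,
    ← Spec.map_comp_assoc, ← CommRingCat.ofHom_comp, awayEval_awayMap]

/-- The morphism to projective space over the integers with the given homogeneous coordinates,
one of which is invertible. -/
def point {Z : Scheme.{u}} (s : Fin (n + 1) → Γ(Z, ⊤)) (i : Fin (n + 1)) (hi : IsUnit (s i)) :
    Z ⟶ IntProjectiveSpace.{u} n :=
  projPoint s (X_mem_intGrading i) one_pos (by simpa using hi)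

lemma comp_projPoint {Z W : Scheme.{u}} (h : W ⟶ Z) (s : Fin (n + 1) → Γ(Z, ⊤))
    {f : MvPolynomial (Fin (n + 1)) (ULift.{u} ℤ)} {d : ℕ} (hd : f ∈ intGrading n d) (h0 : 0 < d)
    (hf : IsUnit (evalInt s f)) (hf' : IsUnit (evalInt (fun j ↦ h.appTop.hom (s j)) f)) :
    h ≫ projPoint s hd h0 hf = projPoint (fun j ↦ h.appTop.hom (s j)) hd h0 hf' := by
  rw [projPoint, projPoint, Scheme.toSpecΓ_naturality_assoc, ← Spec.map_comp_assoc]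
  congr 3
  have := awayEval_comp h.appTop.hom s hf hf' hd
  exact congrArg CommRingCat.ofHom this

lemma comp_point {Z W : Scheme.{u}} (h : W ⟶ Z) (s : Fin (n + 1) → Γ(Z, ⊤)) (i : Fin (n + 1))
    (hi : IsUnit (s i)) :
    h ≫ point s i hi = point (fun j ↦ h.appTop.hom (s j)) i (hi.map h.appTop.hom) :=
  comp_projPoint _ _ _ _ _ _

lemma point_mul_left {Z : Scheme.{u}} (u : Γ(Z, ⊤)) (s : Fin (n + 1) → Γ(Z, ⊤))
    (i : Fin (n + 1)) (hi : IsUnit (s i)) (hi' : IsUnit (u * s i)) :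
    point (fun j ↦ u * s j) i hi' = point s i hi := by
  rw [point, point, projPoint, projPoint, awayEval_mul_left u s (by simpa using hi)
    (by simpa using hi') (X_mem_intGrading i)]

/-- Both charts are compared on the smaller one where `X i * X j` is invertible. -/
lemma point_index_congr {Z : Scheme.{u}} (s : Fin (n + 1) → Γ(Z, ⊤)) (i j : Fin (n + 1))
    (hi : IsUnit (s i)) (hj : IsUnit (s j)) : point s i hi = point s j hj := by
  have h : IsUnit (evalInt.{u} s (MvPolynomial.X i * MvPolynomial.X j)) := by
    simpa using hi.mul hj
  have hm : (MvPolynomial.X i * MvPolynomial.X j : MvPolynomial (Fin (n + 1)) (ULift.{u} ℤ)) ∈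
    intGrading n 2 := SetLike.mul_mem_graded (X_mem_intGrading i) (X_mem_intGrading j)
  rw [point, point,
    ← projPoint_mul s (X_mem_intGrading i) one_pos _ (X_mem_intGrading j) rfl hm rfl two_pos h,
    ← projPoint_mul s (X_mem_intGrading j) one_pos _ (X_mem_intGrading i) (mul_comm _ _)
      hm rfl two_pos h]

/-- The standard open subset of projective space where the `i`-th coordinate is invertible. -/
def chart (i : Fin (n + 1)) : (IntProjectiveSpace.{u} n).Opens :=
  Proj.basicOpen (intGrading n) (MvPolynomial.X i)

lemma exists_mem_chart (x : IntProjectiveSpace.{u} n) : ∃ i, x ∈ chart i := by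
  have h := Proj.iSup_basicOpen_eq_top' (intGrading.{u} n)
    (fun i : Fin (n + 1) ↦ MvPolynomial.X i) (fun i ↦ ⟨1, X_mem_intGrading i⟩) (by
      rw [eq_top_iff]
      rintro p -
      induction p using MvPolynomial.induction_on with
      | C a =>
        exact Subalgebra.algebraMap_mem _
          (⟨MvPolynomial.C a, MvPolynomial.isHomogeneous_C _ _⟩ : intGrading n 0)
      | add p q hp hq => exact add_mem hp hq
      | mul_X p i hp => exact mul_mem hp (Algebra.subset_adjoin ⟨i, rfl⟩))
  have hx : x ∈ (⊤ : (Proj (intGrading.{u} n)).Opens) := trivial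
  rw [← h] at hx
  exact TopologicalSpace.Opens.mem_iSup.mp hx

lemma exists_eq_point_of_range_subset {Z : Scheme.{u}} (t : Z ⟶ IntProjectiveSpace.{u} n)
    (i : Fin (n + 1)) (h : ∀ z, t z ∈ chart i) :
    ∃ (s : Fin (n + 1) → Γ(Z, ⊤)) (hs : s i = 1), t = point s i (hs ▸ isUnit_one) := by
  let ι := Proj.awayι (intGrading.{u} n) (MvPolynomial.X i) (X_mem_intGrading i) one_pos
  have hr : Set.range t ⊆ Set.range ι := by
    rintro _ ⟨z, rfl⟩
    have : t z ∈ ι.opensRange := by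
      rw [Proj.opensRange_awayι]
      exact h z
    exact this
  let l := IsOpenImmersion.lift ι t hr
  have hl : l ≫ ι = t := IsOpenImmersion.lift_fac _ _ _
  obtain ⟨s, hs, hφ⟩ := eq_awayEval i ((Scheme.ΓSpecIso _).inv ≫ l.appTop).hom
  refine ⟨s, hs, ?_⟩
  rw [← hl, point, projPoint, ← Category.assoc]
  congr 1
  have h1 : CommRingCat.ofHom (awayEval s (MvPolynomial.X i) (by simp [hs])) =
      (Scheme.ΓSpecIso _).inv ≫ l.appTop := by
    rw [← hφ]; rfl
  rw [h1, Spec.map_comp, ← Scheme.toSpecΓ_naturality_assoc, toSpecΓ_SpecMap_ΓSpecIso_inv,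
    Category.comp_id]

lemma exists_eq_point {Z : Scheme.{u}} (t : Z ⟶ IntProjectiveSpace.{u} n) (z : Z) :
    ∃ (U : Z.Opens) (i : Fin (n + 1)) (s : Fin (n + 1) → Γ(U, ⊤)) (hs : s i = 1),
      z ∈ U ∧ U.ι ≫ t = point s i (hs ▸ isUnit_one) := by
  obtain ⟨i, hi⟩ := exists_mem_chart (t z)
  obtain ⟨s, hs, h⟩ := exists_eq_point_of_range_subset ((t ⁻¹ᵁ chart i).ι ≫ t) i (fun z ↦ z.2)
  exact ⟨t ⁻¹ᵁ chart i, i, s, hs, hi, h⟩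

lemma projPoint_preimage_basicOpen {Z : Scheme.{u}} (s : Fin (n + 1) → Γ(Z, ⊤))
    (i : Fin (n + 1)) (hi : IsUnit (evalInt.{u} s (MvPolynomial.X i))) (j : Fin (n + 1)) :
    projPoint s (X_mem_intGrading i) one_pos hi ⁻¹ᵁ
      Proj.basicOpen (intGrading n) (MvPolynomial.X j) = Z.basicOpen (s j) := by
  rw [projPoint, Scheme.Hom.comp_preimage, Scheme.Hom.comp_preimage, Proj.awayι_preimage_basicOpen
    (intGrading n) (X_mem_intGrading i) one_pos (X_mem_intGrading j) one_pos]
  change Z.toSpecΓ ⁻¹ᵁ (PrimeSpectrum.basicOpen _) = _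
  rw [Scheme.toSpecΓ_preimage_basicOpen]
  have h := awayEval_mk s hi (X_mem_intGrading i) 1 (MvPolynomial.X j ^ 1)
    (by simpa using X_mem_intGrading j)
  rw [map_pow, evalInt_X, evalInt_X, pow_one (s i), pow_one (s j)] at h
  rw [evalInt_X] at hi
  rw [← h, Scheme.basicOpen_mul, Scheme.basicOpen_of_isUnit _ hi, inf_top_eq]
  rfl

lemma isUnit_of_basicOpen_eq_top {Z : Scheme.{u}} (a : Γ(Z, ⊤)) (h : Z.basicOpen a = ⊤) :
    IsUnit a :=
  RingedSpace.isUnit_of_isUnit_germ _ _ _ fun x hx ↦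
    (Z.mem_basicOpen a x hx).mp (by rw [h]; exact hx)

lemma point_preimage_chart {Z : Scheme.{u}} (s : Fin (n + 1) → Γ(Z, ⊤))
    (i : Fin (n + 1)) (hi : IsUnit (s i)) (j : Fin (n + 1)) :
    point s i hi ⁻¹ᵁ chart j = Z.basicOpen (s j) :=
  projPoint_preimage_basicOpen _ _ _ _

lemma projPoint_eq_projPoint {Z : Scheme.{u}} {s s' : Fin (n + 1) → Γ(Z, ⊤)}
    {i : Fin (n + 1)} {hi : IsUnit (evalInt.{u} s (MvPolynomial.X i))}
    {hi' : IsUnit (evalInt.{u} s' (MvPolynomial.X i))}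
    (h : projPoint s (X_mem_intGrading i) one_pos hi =
      projPoint s' (X_mem_intGrading i) one_pos hi') (j : Fin (n + 1)) :
    s j * s' i = s' j * s i := by
  rw [projPoint, projPoint, ← Category.assoc, ← Category.assoc, cancel_mono] at h
  have h1 := congrArg Scheme.Hom.appTop h
  rw [Scheme.Hom.comp_appTop, Scheme.Hom.comp_appTop, Scheme.toSpecΓ_appTop,
    Scheme.ΓSpecIso_naturality, Scheme.ΓSpecIso_naturality, cancel_epi] at h1
  have h2 : awayEval s (MvPolynomial.X i) hi = awayEval s' (MvPolynomial.X i) hi' :=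
    congrArg CommRingCat.Hom.hom h1
  have e1 := awayEval_mk s hi (X_mem_intGrading i) 1 (MvPolynomial.X j) (X_mem_intGrading j)
  have e2 := awayEval_mk s' hi' (X_mem_intGrading i) 1 (MvPolynomial.X j) (X_mem_intGrading j)
  rw [evalInt_X, evalInt_X, pow_one] at e1 e2
  rw [← e1, ← e2, h2]
  ring

/-- The preimage of the `i`-th chart is everything, so `s' i` is also a unit. Both vectors can then
be read on that single chart, whose immersion is a monomorphism. -/
lemma exists_unit_of_point_eq_point {Z : Scheme.{u}} {s s' : Fin (n + 1) → Γ(Z, ⊤)}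
    {i j : Fin (n + 1)} {hi : IsUnit (s i)} {hj : IsUnit (s' j)}
    (h : point s i hi = point s' j hj) :
    ∃ u : Γ(Z, ⊤), IsUnit u ∧ ∀ k, s k = u * s' k := by
  have hi' : IsUnit (s' i) := by
    have h1 := point_preimage_chart s' j hj i
    rw [← h, point_preimage_chart, Scheme.basicOpen_of_isUnit _ hi] at h1
    exact isUnit_of_basicOpen_eq_top _ h1.symm
  rw [point_index_congr s' j i hj hi'] at h
  have h1 := projPoint_eq_projPoint h
  obtain ⟨v, hv⟩ := hi'
  refine ⟨s i * ↑v⁻¹, hi.mul v⁻¹.isUnit, fun k ↦ ?_⟩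
  rw [← v.mul_left_inj, hv, h1, ← hv]
  linear_combination (-s i * s' k) * v.inv_mul

end ProjectivePoints

/-! ### Invertible matrices acting on projective space -/

section MatrixAction

variable {n : ℕ}

/-- Otherwise, applying the inverse matrix would put `φ (s i)` in the maximal ideal. -/
lemma exists_isUnit_mulVec {B L : Type*} [CommRing B] [CommRing L] [IsLocalRing L] (φ : B →+* L)
    {ι : Type*} [Fintype ι] [DecidableEq ι] (N : Matrix ι ι B) (hN : IsUnit N) (s : ι → B) (i : ι)
    (hi : IsUnit (s i)) : ∃ k, IsUnit (φ (N.mulVec s k)) := by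
  obtain ⟨M, hM⟩ := hN.exists_left_inv
  by_contra! h
  have h1 : s i = M.mulVec (N.mulVec s) i := by
    rw [Matrix.mulVec_mulVec, hM, Matrix.one_mulVec]
  have h2 : φ (s i) ∈ IsLocalRing.maximalIdeal L := by
    rw [h1, Matrix.mulVec, dotProduct, map_sum]
    refine Ideal.sum_mem _ fun k _ ↦ ?_
    rw [map_mul]
    exact Ideal.mul_mem_left _ _ (h k)
  exact h2 (hi.map φ)

/-- The product of a matrix of functions on `S` with a vector of functions on an `S`-scheme. -/
def matAct {S Z : Scheme.{u}} (N : Matrix (Fin (n + 1)) (Fin (n + 1)) Γ(S, ⊤)) (z : Z ⟶ S)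
    (s : Fin (n + 1) → Γ(Z, ⊤)) : Fin (n + 1) → Γ(Z, ⊤) :=
  (N.map z.appTop.hom).mulVec s

lemma appTop_matAct {S Z W : Scheme.{u}} (N : Matrix (Fin (n + 1)) (Fin (n + 1)) Γ(S, ⊤))
    (z : Z ⟶ S) (h : W ⟶ Z) (s : Fin (n + 1) → Γ(Z, ⊤)) (k : Fin (n + 1)) :
    h.appTop.hom (matAct N z s k) = matAct N (h ≫ z) (fun j ↦ h.appTop.hom (s j)) k := by
  rw [matAct, matAct, RingHom.map_mulVec, Matrix.map_map]
  simp only [Scheme.Hom.comp_appTop]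
  rfl

lemma matAct_mul_left {S Z : Scheme.{u}} (N : Matrix (Fin (n + 1)) (Fin (n + 1)) Γ(S, ⊤))
    (z : Z ⟶ S) (u : Γ(Z, ⊤)) (s : Fin (n + 1) → Γ(Z, ⊤)) :
    matAct N z (fun j ↦ u * s j) = fun j ↦ u * matAct N z s j :=
  Matrix.mulVec_smul _ u s

lemma matAct_matAct {S Z : Scheme.{u}} (M N : Matrix (Fin (n + 1)) (Fin (n + 1)) Γ(S, ⊤))
    (z : Z ⟶ S) (s : Fin (n + 1) → Γ(Z, ⊤)) :
    matAct M z (matAct N z s) = matAct (M * N) z s := by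
  rw [matAct, matAct, matAct, Matrix.mulVec_mulVec, Matrix.map_mul]

lemma matAct_one {S Z : Scheme.{u}} (z : Z ⟶ S) (s : Fin (n + 1) → Γ(Z, ⊤)) :
    matAct 1 z s = s := by
  simp [matAct]

lemma point_matAct_congr {S Z : Scheme.{u}} (N : Matrix (Fin (n + 1)) (Fin (n + 1)) Γ(S, ⊤))
    (z : Z ⟶ S) {s s' : Fin (n + 1) → Γ(Z, ⊤)} {i i' k k' : Fin (n + 1)} {hi : IsUnit (s i)}
    {hi' : IsUnit (s' i')} (h : point s i hi = point s' i' hi')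
    (hk : IsUnit (matAct N z s k)) (hk' : IsUnit (matAct N z s' k')) :
    point (matAct N z s) k hk = point (matAct N z s') k' hk' := by
  obtain ⟨u, hu, hus⟩ := exists_unit_of_point_eq_point h
  obtain rfl : s = fun j ↦ u * s' j := funext hus
  have h1 := matAct_mul_left N z u s'
  have hk2 : IsUnit (u * matAct N z s' k') := hu.mul hk'
  have h2 : point (matAct N z fun j ↦ u * s' j) k hk = point (fun j ↦ u * matAct N z s' j) k'
      hk2 := by
    rw [← point_index_congr _ k k' (by simpa [h1] using hk) hk2]
    congr 1
  rw [h2, point_mul_left]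

lemma point_congr {Z : Scheme.{u}} {s s' : Fin (n + 1) → Γ(Z, ⊤)} (h : s = s') {i : Fin (n + 1)}
    (hi : IsUnit (s i)) : point s i hi = point s' i (h ▸ hi) := by
  subst h; rfl

lemma comp_point_matAct {S Z W : Scheme.{u}}
    (N : Matrix (Fin (n + 1)) (Fin (n + 1)) Γ(S, ⊤)) (z : Z ⟶ S) (a : W ⟶ Z) (q : W ⟶ S)
    (hq : a ≫ z = q) (s : Fin (n + 1) → Γ(Z, ⊤)) (k : Fin (n + 1))
    (hk : IsUnit (matAct N z s k)) :
    ∃ hk' : IsUnit (matAct N q (fun j ↦ a.appTop.hom (s j)) k),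
      a ≫ point (matAct N z s) k hk = point (matAct N q (fun j ↦ a.appTop.hom (s j))) k hk' := by
  subst hq
  have h := funext fun k ↦ appTop_matAct N z a s k
  refine ⟨h ▸ hk.map a.appTop.hom, ?_⟩
  rw [comp_point]
  exact point_congr h _

lemma exists_eq_point_matAct {S Z : Scheme.{u}}
    (N : Matrix (Fin (n + 1)) (Fin (n + 1)) Γ(S, ⊤)) (hN : IsUnit N)
    (z : Z ⟶ S) (t : Z ⟶ IntProjectiveSpace.{u} n) (x : Z) :
    ∃ (V : Scheme.{u}) (j : V ⟶ Z) (_ : IsOpenImmersion j) (s : Fin (n + 1) → Γ(V, ⊤))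
      (i : Fin (n + 1)) (hi : IsUnit (s i)) (k : Fin (n + 1)) (_ : IsUnit (matAct N (j ≫ z) s k)),
      x ∈ Set.range j ∧ j ≫ t = point s i hi := by
  obtain ⟨U, i, s, hs, hx, ht⟩ := exists_eq_point t x
  have hi : IsUnit (s i) := hs ▸ isUnit_one
  let x' : U.toScheme := ⟨x, hx⟩
  obtain ⟨k, hk⟩ := exists_isUnit_mulVec (L := U.toScheme.presheaf.stalk x')
    (U.toScheme.presheaf.germ ⊤ x' trivial).hom
    (N.map (U.ι ≫ z).appTop.hom) (hN.map (U.ι ≫ z).appTop.hom.mapMatrix) s i hi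
  let V := U.toScheme.basicOpen (matAct N (U.ι ≫ z) s k)
  refine ⟨V, V.ι ≫ U.ι, inferInstance, fun j ↦ V.ι.appTop.hom (s j), i, hi.map V.ι.appTop.hom, k,
    ?_, ?_, ?_⟩
  · rw [Category.assoc, ← appTop_matAct]
    apply isUnit_of_basicOpen_eq_top
    rw [← Scheme.Hom.preimage_basicOpen_top]
    exact V.ι_preimage_self
  · refine ⟨⟨⟨x, hx⟩, (Scheme.mem_basicOpen_top _ _ _).mpr hk⟩, ?_⟩
    exact (Scheme.Hom.comp_apply V.ι U.ι _).trans rfl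
  · rw [Category.assoc, ht, comp_point]

/-- Local coordinates `s` are replaced by `N s`. They are unique up to a unit, which commutes with
`N`, so the local morphisms glue. Stating the outcome for all `W`-points with coordinates makes
composition of two such actions computable. -/
lemma exists_matrix_translate {S Z : Scheme.{u}}
    (N : Matrix (Fin (n + 1)) (Fin (n + 1)) Γ(S, ⊤)) (hN : IsUnit N)
    (z : Z ⟶ S) (t : Z ⟶ IntProjectiveSpace.{u} n) :
    ∃ t' : Z ⟶ IntProjectiveSpace.{u} n, ∀ (W : Scheme.{u}) (h : W ⟶ Z)
      (s : Fin (n + 1) → Γ(W, ⊤)) (i : Fin (n + 1)) (hi : IsUnit (s i)) (k : Fin (n + 1))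
      (hk : IsUnit (matAct N (h ≫ z) s k)), h ≫ t = point s i hi →
      h ≫ t' = point (matAct N (h ≫ z) s) k hk := by
  choose V j hj s i hi k hk hx ht using exists_eq_point_matAct N hN z t
  let 𝒰 : Z.OpenCover := Scheme.Cover.mkOfCovers Z V j (fun x ↦ ⟨x, hx x⟩) hj
  have key (W : Scheme.{u}) (x y : Z) (a : W ⟶ V x) (b : W ⟶ V y) (hab : a ≫ j x = b ≫ j y) :
      a ≫ point (matAct N (j x ≫ z) (s x)) (k x) (hk x) =
      b ≫ point (matAct N (j y ≫ z) (s y)) (k y) (hk y) := by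
    obtain ⟨hk₁, h₁⟩ := comp_point_matAct N (j x ≫ z) a (a ≫ j x ≫ z) rfl (s x) (k x) (hk x)
    obtain ⟨hk₂, h₂⟩ := comp_point_matAct N (j y ≫ z) b (a ≫ j x ≫ z)
      (by rw [reassoc_of% hab]) (s y) (k y) (hk y)
    rw [h₁, h₂]
    refine point_matAct_congr (i := i x) (i' := i y) (hi := (hi x).map a.appTop.hom)
      (hi' := (hi y).map b.appTop.hom) N _ ?_ _ _
    rw [← comp_point _ _ _ (hi x), ← comp_point _ _ _ (hi y), ← ht, ← ht, reassoc_of% hab]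
  let t' : Z ⟶ IntProjectiveSpace.{u} n :=
    𝒰.glueMorphisms (fun x ↦ point (matAct N (j x ≫ z) (s x)) (k x) (hk x))
      fun x y ↦ key _ x y _ _ pullback.condition
  have ht' (x : Z) : j x ≫ t' = point (matAct N (j x ≫ z) (s x)) (k x) (hk x) :=
    𝒰.ι_glueMorphisms _ _ x
  refine ⟨t', fun W h r i' hi' k' hk' hr ↦ ?_⟩
  suffices hcl : ∀ x : Z, pullback.fst h (j x) ≫ h ≫ t' =
      pullback.fst h (j x) ≫ point (matAct N (h ≫ z) r) k' hk' from
    (Precoverage.ZeroHypercover.pullback₁ h 𝒰).hom_ext hcl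
  intro x
  rw [pullback.condition_assoc, ht']
  obtain ⟨hk₁, h₁⟩ := comp_point_matAct N (j x ≫ z) (pullback.snd h (j x))
    (pullback.fst h (j x) ≫ h ≫ z) (pullback.condition_assoc _).symm (s x) (k x) (hk x)
  obtain ⟨hk₂, h₂⟩ := comp_point_matAct N (h ≫ z) (pullback.fst h (j x)) _ rfl r k' hk'
  rw [h₁, h₂]
  refine point_matAct_congr (i := i x) (i' := i') (hi := (hi x).map (pullback.snd h _).appTop.hom)
      (hi' := hi'.map (pullback.fst h (j x)).appTop.hom) N _ ?_ _ _
  rw [← comp_point _ _ _ (hi x), ← comp_point _ _ _ hi', ← ht, ← hr, pullback.condition_assoc]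

/-- The projection of projective space over `S` to projective space over the integers. -/
def ProjectiveSpace.toInt (n : ℕ) (S : Scheme.{u}) :
    ProjectiveSpace n S ⟶ IntProjectiveSpace.{u} n :=
  pullback.snd (terminal.from S) (terminal.from (IntProjectiveSpace.{u} n))

lemma ProjectiveSpace.hom_ext {S W : Scheme.{u}} {a b : W ⟶ ProjectiveSpace n S}
    (h₁ : a ≫ ProjectiveSpace.toBase n S = b ≫ ProjectiveSpace.toBase n S)
    (h₂ : a ≫ ProjectiveSpace.toInt n S = b ≫ ProjectiveSpace.toInt n S) : a = b :=
  pullback.hom_ext h₁ h₂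

/-- The morphism to projective space over `S` with given components. -/
def ProjectiveSpace.lift {S W : Scheme.{u}} (a : W ⟶ S) (b : W ⟶ IntProjectiveSpace.{u} n) :
    W ⟶ ProjectiveSpace n S :=
  pullback.lift a b (terminal.hom_ext _ _)

@[simp]
lemma ProjectiveSpace.lift_toBase {S W : Scheme.{u}} (a : W ⟶ S)
    (b : W ⟶ IntProjectiveSpace.{u} n) :
    ProjectiveSpace.lift a b ≫ ProjectiveSpace.toBase n S = a :=
  pullback.lift_fst _ _ _

@[simp]
lemma ProjectiveSpace.lift_toInt {S W : Scheme.{u}} (a : W ⟶ S)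
    (b : W ⟶ IntProjectiveSpace.{u} n) :
    ProjectiveSpace.lift a b ≫ ProjectiveSpace.toInt n S = b :=
  pullback.lift_snd _ _ _

lemma matrix_translate_comp_eq_id {S : Scheme.{u}}
    {M N : Matrix (Fin (n + 1)) (Fin (n + 1)) Γ(S, ⊤)} (hN : IsUnit N) (hMN : M * N = 1)
    {a b : ProjectiveSpace n S ⟶ IntProjectiveSpace.{u} n}
    (ha : ∀ (W : Scheme.{u}) (h : W ⟶ ProjectiveSpace n S)
      (s : Fin (n + 1) → Γ(W, ⊤)) (i : Fin (n + 1)) (hi : IsUnit (s i)) (k : Fin (n + 1))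
      (hk : IsUnit (matAct N (h ≫ ProjectiveSpace.toBase n S) s k)),
      h ≫ ProjectiveSpace.toInt n S = point s i hi →
      h ≫ a = point (matAct N (h ≫ ProjectiveSpace.toBase n S) s) k hk)
    (hb : ∀ (W : Scheme.{u}) (h : W ⟶ ProjectiveSpace n S)
      (s : Fin (n + 1) → Γ(W, ⊤)) (i : Fin (n + 1)) (hi : IsUnit (s i)) (k : Fin (n + 1))
      (hk : IsUnit (matAct M (h ≫ ProjectiveSpace.toBase n S) s k)),
      h ≫ ProjectiveSpace.toInt n S = point s i hi →
      h ≫ b = point (matAct M (h ≫ ProjectiveSpace.toBase n S) s) k hk) :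
    ProjectiveSpace.lift (ProjectiveSpace.toBase n S) a ≫
      ProjectiveSpace.lift (ProjectiveSpace.toBase n S) b = 𝟙 _ := by
  refine ProjectiveSpace.hom_ext (by simp) ?_
  rw [Category.assoc, ProjectiveSpace.lift_toInt, Category.id_comp]
  choose V j hj s i hi k hk hx ht using
    exists_eq_point_matAct N hN (ProjectiveSpace.toBase n S) (ProjectiveSpace.toInt n S)
  let 𝒰 : (ProjectiveSpace n S).OpenCover :=
    Scheme.Cover.mkOfCovers _ V j (fun x ↦ ⟨x, hx x⟩) hj
  refine Precoverage.ZeroHypercover.hom_ext 𝒰 fun x ↦ ?_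
  change j x ≫ _ = j x ≫ _
  have h1 := ha _ (j x) (s x) (i x) (hi x) (k x) (hk x) (ht x)
  have hM : matAct M ((j x ≫ ProjectiveSpace.lift (ProjectiveSpace.toBase n S) a) ≫
      ProjectiveSpace.toBase n S) (matAct N (j x ≫ ProjectiveSpace.toBase n S) (s x)) = s x := by
    rw [Category.assoc, ProjectiveSpace.lift_toBase, matAct_matAct, hMN, matAct_one]
  have h2 := hb _ (j x ≫ ProjectiveSpace.lift (ProjectiveSpace.toBase n S) a)
    (matAct N (j x ≫ ProjectiveSpace.toBase n S) (s x)) (k x) (hk x) (i x)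
    (by rw [hM]; exact hi x) (by rw [Category.assoc, ProjectiveSpace.lift_toInt, h1])
  rw [Category.assoc] at h2
  exact (h2.trans (point_congr hM _)).trans (ht x).symm

/-- Invertible matrices over `S` act on projective space over `S`. -/
lemma exists_matrix_automorphism {S : Scheme.{u}}
    (N : Matrix (Fin (n + 1)) (Fin (n + 1)) Γ(S, ⊤)) (hN : IsUnit N) :
    ∃ α : ProjectiveSpace n S ⟶ ProjectiveSpace n S, IsIso α ∧
      α ≫ ProjectiveSpace.toBase n S = ProjectiveSpace.toBase n S ∧
      ∀ (W : Scheme.{u}) (h : W ⟶ ProjectiveSpace n S)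
        (s : Fin (n + 1) → Γ(W, ⊤)) (i : Fin (n + 1)) (hi : IsUnit (s i)) (k : Fin (n + 1))
        (hk : IsUnit (matAct N (h ≫ ProjectiveSpace.toBase n S) s k)),
        h ≫ ProjectiveSpace.toInt n S = point s i hi →
        h ≫ α ≫ ProjectiveSpace.toInt n S =
          point (matAct N (h ≫ ProjectiveSpace.toBase n S) s) k hk := by
  obtain ⟨N, rfl⟩ := hN
  obtain ⟨a, ha⟩ := exists_matrix_translate N.1 N.isUnit (ProjectiveSpace.toBase n S)
    (ProjectiveSpace.toInt n S)
  obtain ⟨b, hb⟩ := exists_matrix_translate (N⁻¹).1 N⁻¹.isUnit (ProjectiveSpace.toBase n S)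
    (ProjectiveSpace.toInt n S)
  refine ⟨ProjectiveSpace.lift (ProjectiveSpace.toBase n S) a,
    ⟨ProjectiveSpace.lift (ProjectiveSpace.toBase n S) b,
      matrix_translate_comp_eq_id N.isUnit N.inv_mul ha hb,
      matrix_translate_comp_eq_id N⁻¹.isUnit N.mul_inv hb ha⟩, by simp, ?_⟩
  intro W h s i hi k hk hs
  rw [ProjectiveSpace.lift_toInt]
  exact ha W h s i hi k hk hs

end MatrixAction

/-! ### Scheme-theoretic images and flat base change -/

lemma isSchemeTheoreticallyDominant_toImage {X Y : Scheme.{u}} (f : X ⟶ Y) [QuasiCompact f] :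
    IsSchemeTheoreticallyDominant f.toImage := by
  rw [isSchemeTheoreticallyDominant_iff]
  refine Scheme.IdealSheafData.ext_of_iSup_eq_top
    (fun U : Y.affineOpens ↦ ⟨f.imageι ⁻¹ᵁ U.1, U.2.preimage f.imageι⟩) ?_ fun U ↦ ?_
  · rw [← Scheme.Hom.preimage_iSup, iSup_affineOpens_eq_top, Scheme.Hom.preimage_top]
  · rw [Scheme.Hom.ker_apply, (RingHom.injective_iff_ker_eq_bot _).mp (f.toImage_app_injective U)]
    rfl

lemma ker_comp_of_isSchemeTheoreticallyDominant {X Y Z : Scheme.{u}} (f : X ⟶ Y) (g : Y ⟶ Z)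
    [IsSchemeTheoreticallyDominant f] : (f ≫ g).ker = g.ker := by
  rw [Scheme.Hom.ker_comp, f.ker_eq_bot, Scheme.IdealSheafData.map_bot]

/-- Both closed subschemes are cut out by the kernel ideal of the common morphism `V ⟶ P`. -/
lemma exists_iso_of_isSchemeTheoreticallyDominant {V Y Z P : Scheme.{u}} (a : V ⟶ Y) (b : V ⟶ Z)
    (j : Y ⟶ P) (k : Z ⟶ P) [IsClosedImmersion j] [IsClosedImmersion k]
    [IsSchemeTheoreticallyDominant a] [IsSchemeTheoreticallyDominant b] (h : a ≫ j = b ≫ k) :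
    ∃ e : Y ≅ Z, e.hom ≫ k = j := by
  have hk : k.ker = j.ker := by
    rw [← ker_comp_of_isSchemeTheoreticallyDominant a j, h,
      ker_comp_of_isSchemeTheoreticallyDominant]
  have := IsClosedImmersion.isIso_lift k j hk
  exact ⟨asIso (IsClosedImmersion.lift k j hk.le), IsClosedImmersion.lift_fac _ _ _⟩

/-- Projective space is compatible with base change. -/
lemma ProjectiveSpace.isPullback_lift (n : ℕ) {X S : Scheme.{u}} (u : X ⟶ S) :
    IsPullback (ProjectiveSpace.lift (ProjectiveSpace.toBase n X ≫ u) (ProjectiveSpace.toInt n X))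
      (ProjectiveSpace.toBase n X) (ProjectiveSpace.toBase n S) u := by
  refine IsPullback.of_right (h₁₂ := ProjectiveSpace.toInt n S)
    (v₁₃ := terminal.from (IntProjectiveSpace.{u} n)) (h₂₂ := terminal.from S) ?_
    (ProjectiveSpace.lift_toBase _ _) (IsPullback.of_hasPullback _ _).flip
  rw [ProjectiveSpace.lift_toInt, terminal.comp_from]
  exact (IsPullback.of_hasPullback _ _).flip

/-- `Ybar` is the scheme-theoretic image of `W₀` in `ℙⁿ_S`. Its base change to `X` receives `W`, and
so `V`, dominantly, as `Y` does; hence the two closed subschemes of `ℙⁿ_X` agree. In the application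
`W₀ = Spec F₀`, `W = Spec (F₀ ⊗ R)` and `V = Spec F`. -/
lemma exists_isPullback_of_flat {n : ℕ} {S X W₀ W V Y : Scheme.{u}} (u : X ⟶ S) [Flat u]
    (q : W₀ ⟶ S) (w : W₀ ⟶ IntProjectiveSpace.{u} n) [QuasiCompact (ProjectiveSpace.lift q w)]
    {b : W ⟶ W₀} {p : W ⟶ X} (hW : IsPullback b p q u) (a : V ⟶ W)
    [IsSchemeTheoreticallyDominant a] (y : V ⟶ Y) [IsSchemeTheoreticallyDominant y]
    (j : Y ⟶ ProjectiveSpace n X) [IsClosedImmersion j]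
    (h₁ : y ≫ j ≫ ProjectiveSpace.toBase n X = a ≫ p)
    (h₂ : y ≫ j ≫ ProjectiveSpace.toInt n X = a ≫ b ≫ w) :
    ∃ (Ybar : Scheme.{u}) (k : Ybar ⟶ ProjectiveSpace n S) (g : Y ⟶ Ybar), IsClosedImmersion k ∧
      IsPullback g (j ≫ ProjectiveSpace.toBase n X) (k ≫ ProjectiveSpace.toBase n S) u := by
  let c := ProjectiveSpace.lift q w
  let ρ := ProjectiveSpace.lift (ProjectiveSpace.toBase n X ≫ u) (ProjectiveSpace.toInt n X)
  have hρ : IsPullback ρ (ProjectiveSpace.toBase n X) (ProjectiveSpace.toBase n S) u :=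
    ProjectiveSpace.isPullback_lift n u
  have : QuasiCompact c := ‹_›
  have : IsSchemeTheoreticallyDominant c.toImage := isSchemeTheoreticallyDominant_toImage c
  have : Flat ρ := MorphismProperty.of_isPullback hρ.flip ‹Flat u›
  have hc : c = c.toImage ≫ c.imageι := c.toImage_imageι.symm
  let k' := pullback.snd c.imageι ρ
  have hZ : IsPullback (pullback.fst c.imageι ρ) (k' ≫ ProjectiveSpace.toBase n X)
      (c.imageι ≫ ProjectiveSpace.toBase n S) u :=
    (IsPullback.of_hasPullback c.imageι ρ).paste_vert hρ
  let z : W ⟶ pullback c.imageι ρ := pullback.lift (b ≫ c.toImage) (ProjectiveSpace.lift p (b ≫ w))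
    (by
      rw [Category.assoc, ← hc]
      refine ProjectiveSpace.hom_ext ?_ ?_ <;>
        simp [ρ, c, hW.w, reassoc_of% ProjectiveSpace.lift_toBase p (b ≫ w)])
  have hz : IsPullback b z c.toImage (pullback.fst c.imageι ρ) := by
    refine IsPullback.of_bot (v₂₁ := k' ≫ ProjectiveSpace.toBase n X)
      (v₂₂ := c.imageι ≫ ProjectiveSpace.toBase n S) (h₃₁ := u) ?_
      (pullback.lift_fst _ _ _).symm hZ
    rw [← Category.assoc c.toImage, ← hc, ProjectiveSpace.lift_toBase, ← Category.assoc z,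
      pullback.lift_snd, ProjectiveSpace.lift_toBase]
    exact hW
  -- Flatness enters here: `z` is the base change of `W₀ ⟶ c.image` along a base change of `ρ`.
  have : IsSchemeTheoreticallyDominant z := .of_isPullback hz
  obtain ⟨e, he⟩ := exists_iso_of_isSchemeTheoreticallyDominant y (a ≫ z) j k' (by
    rw [Category.assoc, pullback.lift_snd]
    refine ProjectiveSpace.hom_ext ?_ ?_
    · rw [Category.assoc, h₁, Category.assoc, ProjectiveSpace.lift_toBase]
    · rw [Category.assoc, h₂, Category.assoc, ProjectiveSpace.lift_toInt])
  refine ⟨c.image, c.imageι, e.hom ≫ pullback.fst _ _, inferInstance, ?_⟩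
  refine IsPullback.of_iso hZ e.symm (Iso.refl _) (Iso.refl _) (Iso.refl _) ?_ ?_ ?_ ?_
  · simp
  · simp [← he]
  · simp
  · simp

-- Clearing denominators turns any tensor into some `1 ⊗ r`, and `R → F` is injective.
open TensorProduct in
lemma injective_lift_fractionRing {A R F₀ F : Type u} [CommRing A] [CommRing R] [Field F₀]
    [Field F] [Algebra A R] [Algebra A F₀] [Algebra R F] [Algebra F₀ F] [Algebra A F]
    [IsScalarTower A R F] [IsScalarTower A F₀ F] [IsDomain A] [IsFractionRing A F₀]
    [FaithfulSMul R F] :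
    Function.Injective (Algebra.TensorProduct.lift (IsScalarTower.toAlgHom A F₀ F)
      (IsScalarTower.toAlgHom A R F) fun _ _ ↦ Commute.all _ _) := by
  rw [injective_iff_map_eq_zero]
  intro x hx
  obtain ⟨a, ha, r, hr⟩ : ∃ a : A, a ≠ 0 ∧ ∃ r : R, a • x = (1 : F₀) ⊗ₜ[A] r := by
    clear hx
    induction x with
    | zero => exact ⟨1, one_ne_zero, 0, by simp⟩
    | tmul b r =>
      obtain ⟨⟨b, a⟩, hab⟩ := IsLocalization.surj (nonZeroDivisors A) b
      refine ⟨a, nonZeroDivisors.ne_zero a.2, b • r, ?_⟩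
      rw [TensorProduct.smul_tmul', ← TensorProduct.smul_tmul, Algebra.smul_def, mul_comm, hab,
        Algebra.algebraMap_eq_smul_one]
    | add x y hx hy =>
      obtain ⟨a, ha, r, hr⟩ := hx
      obtain ⟨b, hb, t, ht⟩ := hy
      refine ⟨a * b, mul_ne_zero ha hb, b • r + a • t, ?_⟩
      rw [smul_add, mul_comm, mul_smul, hr, mul_comm, mul_smul, ht, TensorProduct.tmul_add,
        TensorProduct.tmul_smul, TensorProduct.tmul_smul]
  have hr0 : algebraMap R F r = 0 := by
    have := congrArg (Algebra.TensorProduct.lift (IsScalarTower.toAlgHom A F₀ F)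
      (IsScalarTower.toAlgHom A R F) fun _ _ ↦ Commute.all _ _) hr
    rw [map_smul, hx, smul_zero] at this
    simpa using this.symm
  rw [map_eq_zero_iff _ (FaithfulSMul.algebraMap_injective R F)] at hr0
  rw [hr0, TensorProduct.tmul_zero] at hr
  have ha' : algebraMap A F₀ a ≠ 0 := by
    simpa using ha
  have h : (algebraMap A F₀ a)⁻¹ • algebraMap A F₀ a • x = 0 := by
    rw [algebraMap_smul, hr, smul_zero]
  rwa [inv_smul_smul₀ ha'] at h

lemma isSchemeTheoreticallyDominant_SpecMap {A B : CommRingCat.{u}} (φ : A ⟶ B)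
    (h : Function.Injective φ.hom) : IsSchemeTheoreticallyDominant (Spec.map φ) := by
  rw [isSchemeTheoreticallyDominant_iff]
  refine Scheme.IdealSheafData.ext_of_isAffine ?_
  rw [Scheme.Hom.ker_apply, Scheme.IdealSheafData.ideal_bot, Pi.bot_apply]
  refine (RingHom.injective_iff_ker_eq_bot _).mp ?_
  have h1 : (Spec.map φ).app ⊤ =
      (Scheme.ΓSpecIso A).hom ≫ φ ≫ (Scheme.ΓSpecIso B).inv := by
    rw [← Category.assoc, ← Scheme.ΓSpecIso_naturality, Category.assoc, Iso.hom_inv_id,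
      Category.comp_id]
  have h2 : Function.Injective ((Spec.map φ).app ⊤) := by
    rw [h1]
    exact ((ConcreteCategory.bijective_of_isIso (Scheme.ΓSpecIso B).inv).1.comp h).comp
      (ConcreteCategory.bijective_of_isIso (Scheme.ΓSpecIso A).hom).1
  exact h2

/-! ### Points of projective space with values in a ring -/

section SpecPoint

variable {n : ℕ} {B C : Type u} [CommRing B] [CommRing C]

/-- The morphism from `Spec B` to projective space given by homogeneous coordinates in `B`, one
of which is a unit. -/
def specPoint (s : Fin (n + 1) → B) (i : Fin (n + 1)) (hi : IsUnit (s i)) :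
    Spec (CommRingCat.of B) ⟶ IntProjectiveSpace.{u} n :=
  point (fun j ↦ (Scheme.ΓSpecIso (CommRingCat.of B)).inv.hom (s j)) i (hi.map _)

lemma specMap_comp_specPoint (φ : B →+* C) (s : Fin (n + 1) → B) (i : Fin (n + 1))
    (hi : IsUnit (s i)) : Spec.map (CommRingCat.ofHom φ) ≫ specPoint s i hi =
      specPoint (fun j ↦ φ (s j)) i (hi.map φ) := by
  rw [specPoint, comp_point]
  refine point_congr (funext fun j ↦ ?_) _
  exact congr($(Scheme.ΓSpecIso_inv_naturality (CommRingCat.ofHom φ)).hom (s j)).symm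

lemma exists_unit_of_specPoint_eq {s s' : Fin (n + 1) → B} {i j : Fin (n + 1)}
    {hi : IsUnit (s i)} {hj : IsUnit (s' j)} (h : specPoint s i hi = specPoint s' j hj) :
    ∃ u : B, IsUnit u ∧ ∀ k, s k = u * s' k := by
  obtain ⟨u, hu, h⟩ := exists_unit_of_point_eq_point h
  refine ⟨(Scheme.ΓSpecIso (CommRingCat.of B)).hom.hom u, hu.map _, fun k ↦ ?_⟩
  have := congrArg (Scheme.ΓSpecIso (CommRingCat.of B)).hom.hom (h k)
  rw [map_mul] at this
  simpa [← CommRingCat.comp_apply] using this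

lemma specPoint_mul_left (u : B) (s : Fin (n + 1) → B) (i j : Fin (n + 1)) (hi : IsUnit (s i))
    (hj : IsUnit (u * s j)) : specPoint (fun k ↦ u * s k) j hj = specPoint s i hi := by
  have hj' : IsUnit (s j) := isUnit_of_mul_isUnit_right hj
  let φ := (Scheme.ΓSpecIso (CommRingCat.of B)).inv.hom
  have h : IsUnit (φ u * φ (s j)) := by
    rw [← map_mul]
    exact hj.map _
  have h1 : specPoint s i hi = specPoint s j hj' := point_index_congr _ _ _ _ _
  rw [h1, specPoint, specPoint, ← point_mul_left (φ u) (fun k ↦ φ (s k)) j (hj'.map φ) h]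
  exact point_congr (funext fun k ↦ map_mul _ _ _) _

/-- Every point of `Spec B` specializes to the closed point, so a chart containing the image of the
closed point contains the whole image. -/
lemma exists_eq_specPoint [IsLocalRing B] (t : Spec (CommRingCat.of B) ⟶ IntProjectiveSpace.{u} n) :
    ∃ (s : Fin (n + 1) → B) (i : Fin (n + 1)) (hs : s i = 1),
      t = specPoint s i (hs ▸ isUnit_one) := by
  obtain ⟨i, hi⟩ := exists_mem_chart (t (IsLocalRing.closedPoint B))
  have h (z) : t z ∈ chart i :=
    (IsLocalRing.specializes_closedPoint z).map t.continuous |>.mem_open (chart i).isOpen hi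
  obtain ⟨s, hs, h⟩ := exists_eq_point_of_range_subset t i h
  refine ⟨fun j ↦ (Scheme.ΓSpecIso (CommRingCat.of B)).hom.hom (s j), i, by simp [hs], ?_⟩
  rw [h, specPoint]
  refine point_congr (funext fun j ↦ ?_) _
  simp

end SpecPoint

open TensorProduct in
lemma exists_isPullback_of_specPoint {n : ℕ} {A R F : Type u} [CommRing A] [IsDomain A]
    [CommRing R] [Field F] [Algebra A R] [Module.Flat A R] [Algebra R F] [FaithfulSMul R F]
    [FaithfulSMul A R] {Y : Scheme.{u}}
    (j : Y ⟶ ProjectiveSpace n (Spec (CommRingCat.of R))) [IsClosedImmersion j]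
    (y : Spec (CommRingCat.of F) ⟶ Y) [IsSchemeTheoreticallyDominant y]
    (h₁ : y ≫ j ≫ ProjectiveSpace.toBase n _ = Spec.map (CommRingCat.ofHom (algebraMap R F)))
    (g : Fin (n + 1) → A) (i : Fin (n + 1)) (hi : IsUnit (algebraMap R F (algebraMap A R (g i))))
    (h₂ : y ≫ j ≫ ProjectiveSpace.toInt n _ =
      specPoint (fun k ↦ algebraMap R F (algebraMap A R (g k))) i hi) :
    ∃ (Ybar : Scheme.{u}) (k : Ybar ⟶ ProjectiveSpace n (Spec (CommRingCat.of A)))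
      (f : Y ⟶ Ybar), IsClosedImmersion k ∧
      IsPullback f (j ≫ ProjectiveSpace.toBase n _) (k ≫ ProjectiveSpace.toBase n _)
        (Spec.map (CommRingCat.ofHom (algebraMap A R))) := by
  let _ : Algebra A F := ((algebraMap R F).comp (algebraMap A R)).toAlgebra
  have : IsScalarTower A R F := .of_algebraMap_eq fun _ ↦ rfl
  have : FaithfulSMul A F := .trans A R F
  let F₀ := FractionRing A
  let _ : Algebra F₀ F := FractionRing.liftAlgebra A F
  have : IsScalarTower A F₀ F := FractionRing.isScalarTower_liftAlgebra A F
  have hg : IsUnit (algebraMap A F₀ (g i)) := by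
    rw [isUnit_iff_ne_zero] at hi ⊢
    intro h
    rw [← IsScalarTower.algebraMap_apply A R F, IsScalarTower.algebraMap_apply A F₀ F, h,
      map_zero] at hi
    exact hi rfl
  have : Flat (Spec.map (CommRingCat.ofHom (algebraMap A R))) := by
    rw [HasRingHomProperty.Spec_iff (P := @Flat)]
    exact (RingHom.flat_algebraMap_iff).mpr inferInstance
  let l := Algebra.TensorProduct.lift (IsScalarTower.toAlgHom A F₀ F)
      (IsScalarTower.toAlgHom A R F) fun _ _ ↦ Commute.all _ _
  have hl : IsSchemeTheoreticallyDominant (Spec.map (CommRingCat.ofHom l.toRingHom)) :=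
    isSchemeTheoreticallyDominant_SpecMap _ injective_lift_fractionRing
  refine exists_isPullback_of_flat (Spec.map (CommRingCat.ofHom (algebraMap A R)))
    (Spec.map (CommRingCat.ofHom (algebraMap A F₀)))
    (specPoint (fun k ↦ algebraMap A F₀ (g k)) i hg)
    (isPullback_SpecMap_of_isPushout _ _ _ _ (CommRingCat.isPushout_tensorProduct A F₀ R))
    (Spec.map (CommRingCat.ofHom l.toRingHom)) y j ?_ ?_
  · rw [h₁, ← Spec.map_comp, ← CommRingCat.ofHom_comp]
    congr 2
    ext r
    simp [l]
  · rw [h₂, ← Category.assoc, ← Spec.map_comp, ← CommRingCat.ofHom_comp, specMap_comp_specPoint]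
    congr 1
    ext k
    simp [l, ← IsScalarTower.algebraMap_apply]

/-! ### Lifting points through a morphism that is an isomorphism over an open set -/

lemma exists_unique_lift_of_isIso_restrict {X Y W : Scheme.{u}} (f : Y ⟶ X) (U : X.Opens)
    [IsIso (f ∣_ U)] (h : W ⟶ X) (hU : Set.range h ⊆ U) : ∃! a : W ⟶ Y, a ≫ f = h := by
  have hr : Set.range h ⊆ Set.range U.ι := by simpa using hU
  let l := IsOpenImmersion.lift U.ι h hr
  have hl : l ≫ U.ι = h := IsOpenImmersion.lift_fac _ _ _
  have H := isPullback_morphismRestrict f U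
  refine ⟨l ≫ inv (f ∣_ U) ≫ (f ⁻¹ᵁ U).ι, ?_, fun a ha ↦ ?_⟩
  · simp only [Category.assoc]
    rw [← H.w, IsIso.inv_hom_id_assoc, hl]
  · have hla : l ≫ U.ι = a ≫ f := by rw [hl, ha]
    have h1 : H.lift l a hla = l ≫ inv (f ∣_ U) := by
      rw [IsIso.eq_comp_inv, H.lift_fst]
    rw [← Category.assoc, ← h1, H.lift_snd]

/-- The lift is dominant into the preimage of `U`, a nonempty open subset of the irreducible `Y`,
hence dense. -/
lemma isDominant_lift_of_isIso_restrict {X Y W : Scheme.{u}} [IrreducibleSpace Y] [Nonempty W]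
    (f : Y ⟶ X) (U : X.Opens) [IsIso (f ∣_ U)] (a : W ⟶ Y) (hU : Set.range (a ≫ f) ⊆ U)
    [IsDominant (a ≫ f)] : IsDominant a := by
  have hr : Set.range a ⊆ Set.range (f ⁻¹ᵁ U).ι := by
    rintro _ ⟨w, rfl⟩
    simpa using hU ⟨w, rfl⟩
  have hl := IsOpenImmersion.lift_fac (f ⁻¹ᵁ U).ι a hr
  have h1 : IsDominant ((IsOpenImmersion.lift (f ⁻¹ᵁ U).ι a hr ≫ f ∣_ U) ≫ U.ι) := by
    rwa [Category.assoc, (isPullback_morphismRestrict f U).w, reassoc_of% hl]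
  have h2 := IsDominant.of_comp_of_isOpenImmersion _ _ (H := h1)
  have h3 : IsDominant (IsOpenImmersion.lift (f ⁻¹ᵁ U).ι a hr) := by
    have : IsDominant ((IsOpenImmersion.lift (f ⁻¹ᵁ U).ι a hr ≫ f ∣_ U) ≫ inv (f ∣_ U)) :=
      inferInstance
    rwa [Category.assoc, IsIso.hom_inv_id, Category.comp_id] at this
  have h4 : IsDominant (f ⁻¹ᵁ U).ι := by
    obtain ⟨w⟩ := ‹Nonempty W›
    exact Opens.isDominant_ι ((f ⁻¹ᵁ U).isOpen.dense ⟨a w, hU ⟨w, rfl⟩⟩)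
  rw [← hl]
  infer_instance

lemma range_specMap_subset {R B : Type u} [CommRing R] [IsLocalRing R] [CommRing B] (φ : R →+* B)
    (x : R) (hx : x ∈ IsLocalRing.maximalIdeal R) (hφ : IsUnit (φ x)) :
    Set.range (Spec.map (CommRingCat.ofHom φ)) ⊆ {IsLocalRing.closedPoint R}ᶜ := by
  rintro _ ⟨z, rfl⟩ hz
  have h1 : (PrimeSpectrum.comap φ z).asIdeal = IsLocalRing.maximalIdeal R :=
    congrArg PrimeSpectrum.asIdeal hz
  have h2 : φ x ∈ z.asIdeal := by
    rw [← h1] at hx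
    exact hx
  exact z.isPrime.ne_top (Ideal.eq_top_of_isUnit_mem _ h2 hφ)

/-- A morphism from the generic point of a local domain to projective space that extends over the
localization at a prime has primitive coordinates which are proportional to coordinates not all in
that prime. -/
lemma exists_proportional_of_specPoint {n : ℕ} {R F : Type u} [CommRing R] [IsDomain R] [Field F]
    [Algebra R F] [IsFractionRing R F] (p : Ideal R) [p.IsPrime] (f : Fin (n + 1) → R)
    (i : Fin (n + 1)) (hi : IsUnit (algebraMap R F (f i)))
    (φ : Localization.AtPrime p →+* F) (hφ : φ.comp (algebraMap R _) = algebraMap R F)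
    (t : Spec (CommRingCat.of (Localization.AtPrime p)) ⟶ IntProjectiveSpace.{u} n)
    (ht : Spec.map (CommRingCat.ofHom φ) ≫ t = specPoint (fun k ↦ algebraMap R F (f k)) i hi) :
    ∃ (l : Fin (n + 1)) (a : Fin (n + 1) → R), a l ∉ p ∧ ∀ j, a j * f l = a l * f j := by
  obtain ⟨r, l, hl, rfl⟩ := exists_eq_specPoint t
  rw [specMap_comp_specPoint] at ht
  obtain ⟨w, hw, hrw⟩ := exists_unit_of_specPoint_eq ht
  obtain ⟨s, hs⟩ := IsLocalization.exist_integer_multiples_of_finite p.primeCompl r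
  choose a ha using hs
  have hφ' (x : R) : φ (algebraMap R _ x) = algebraMap R F x := congr($hφ x)
  have ha' (j) : algebraMap R F (a j) = algebraMap R F s * w * algebraMap R F (f j) := by
    rw [← hφ', ha, Algebra.smul_def, map_mul, hφ', hrw, mul_assoc]
  refine ⟨l, a, fun h ↦ ?_, fun j ↦ ?_⟩
  · have h1 := ha l
    rw [hl, Algebra.smul_def, mul_one] at h1
    have h2 : a l = s := by
      apply IsFractionRing.injective R F
      rw [← hφ', h1, hφ']
    exact s.2 (h2 ▸ h)
  · apply IsFractionRing.injective R F
    rw [map_mul, map_mul, ha', ha']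
    ring

lemma exists_specMatrix_automorphism {n : ℕ} {R : Type u} [CommRing R]
    (N : Matrix (Fin (n + 1)) (Fin (n + 1)) R) (hN : IsUnit N) :
    ∃ α : ProjectiveSpace n (Spec (CommRingCat.of R)) ⟶ ProjectiveSpace n (Spec (CommRingCat.of R)),
      IsIso α ∧ α ≫ ProjectiveSpace.toBase n _ = ProjectiveSpace.toBase n _ ∧
      ∀ (B : Type u) [CommRing B] (φ : R →+* B) (h : Spec (CommRingCat.of B) ⟶ ProjectiveSpace n _)
        (s : Fin (n + 1) → B) (i : Fin (n + 1)) (hi : IsUnit (s i)) (k : Fin (n + 1))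
        (hk : IsUnit ((N.map φ).mulVec s k)),
        h ≫ ProjectiveSpace.toBase n _ = Spec.map (CommRingCat.ofHom φ) →
        h ≫ ProjectiveSpace.toInt n _ = specPoint s i hi →
        h ≫ α ≫ ProjectiveSpace.toInt n _ = specPoint ((N.map φ).mulVec s) k hk := by
  let ψ := (Scheme.ΓSpecIso (CommRingCat.of R)).inv.hom
  obtain ⟨α, hα, hαb, h⟩ := exists_matrix_automorphism (S := Spec (CommRingCat.of R)) (N.map ψ)
    (hN.map ψ.mapMatrix)
  refine ⟨α, hα, hαb, fun B _ φ h' s i hi k hk hb hs ↦ ?_⟩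
  have h1 : matAct (N.map ψ) (h' ≫ ProjectiveSpace.toBase n _)
      (fun j ↦ (Scheme.ΓSpecIso (CommRingCat.of B)).inv.hom (s j)) =
      fun j ↦ (Scheme.ΓSpecIso (CommRingCat.of B)).inv.hom ((N.map φ).mulVec s j) := by
    ext j
    rw [hb, RingHom.map_mulVec, matAct, Matrix.map_map, Matrix.map_map]
    congr 2
    refine funext fun a ↦ ?_
    exact congr($(Scheme.ΓSpecIso_inv_naturality (CommRingCat.ofHom φ)).hom a).symm
  rw [h _ h' _ i (hi.map _) k (by rw [h1]; exact hk.map _) hs, specPoint]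
  exact point_congr h1 _

/-! ### Descent from power series to polynomials -/

lemma algebraMap_mvPolynomial_mvPowerSeries (σ K : Type*) [Field K] :
    algebraMap (MvPolynomial σ K) (MvPowerSeries σ K) =
      MvPolynomial.coeToMvPowerSeries.ringHom := by
  ext <;> simp [MvPowerSeries.algebraMap_apply']

lemma bijective_coe_of_isEmpty (σ K : Type*) [IsEmpty σ] [CommRing K] :
    Function.Bijective (MvPolynomial.coeToMvPowerSeries.ringHom (σ := σ) (R := K)) := by
  refine ⟨MvPolynomial.coe_injective σ K, fun f ↦ ⟨.C (MvPowerSeries.constantCoeff f), ?_⟩⟩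
  ext m
  obtain rfl : m = 0 := Subsingleton.elim _ _
  simp

lemma exists_isPullback_of_isIso_restrict {d : ℕ} (hd : d ≠ 0) (K : Type u) [Field K]
    {Y : Scheme.{u}} [IsIntegral Y] {n : ℕ}
    (j : Y ⟶ ProjectiveSpace n (Spec (CommRingCat.of (MvPowerSeries (Fin d) K))))
    (hc : IsClosedImmersion j) (U : (Spec (CommRingCat.of (MvPowerSeries (Fin d) K))).Opens)
    (hU : ({IsLocalRing.closedPoint (MvPowerSeries (Fin d) K)}ᶜ :
      Set (Spec (CommRingCat.of (MvPowerSeries (Fin d) K)))) ⊆ U)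
    (hj : IsIso ((j ≫ ProjectiveSpace.toBase n _) ∣_ U)) :
    ∃ (Ybar : Scheme.{u}) (k : Ybar ⟶ ProjectiveSpace n (Spec (CommRingCat.of
      (MvPolynomial (Fin d) K)))) (g : Y ⟶ Ybar), IsClosedImmersion k ∧
      IsPullback g (j ≫ ProjectiveSpace.toBase n _) (k ≫ ProjectiveSpace.toBase n _)
        (Spec.map (CommRingCat.ofHom
          (algebraMap (MvPolynomial (Fin d) K) (MvPowerSeries (Fin d) K)))) := by
  let R := MvPowerSeries (Fin d) K
  let F := FractionRing R
  have : UniqueFactorizationMonoid R := uniqueFactorizationMonoid_mvPowerSeries d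
  -- A nonzero element of the maximal ideal, available because `d ≠ 0`; it shows that the generic
  -- point is not the closed point.
  let x₀ : R := MvPowerSeries.X ⟨0, Nat.pos_of_ne_zero hd⟩
  have hx₀ : x₀ ∈ IsLocalRing.maximalIdeal R := by
    rw [maximalIdeal_mvPowerSeries]
    exact Ideal.subset_span ⟨_, rfl⟩
  have hx₀' : IsUnit (algebraMap R F x₀) := by
    rw [isUnit_iff_ne_zero, map_ne_zero_iff _ (IsFractionRing.injective R F)]
    intro h
    simpa [x₀, MvPowerSeries.coeff_index_single_self_X] using
      congrArg (MvPowerSeries.coeff (Finsupp.single ⟨0, Nat.pos_of_ne_zero hd⟩ 1)) h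
  have hη := (range_specMap_subset (algebraMap R F) x₀ hx₀ hx₀').trans hU
  obtain ⟨y, hy, hyu⟩ := exists_unique_lift_of_isIso_restrict (j ≫ ProjectiveSpace.toBase n _) U
    (Spec.map (CommRingCat.ofHom (algebraMap R F))) hη
  have : IsSchemeTheoreticallyDominant (Spec.map (CommRingCat.ofHom (algebraMap R F))) :=
    isSchemeTheoreticallyDominant_SpecMap _ (IsFractionRing.injective R F)
  have : IsDominant (y ≫ j ≫ ProjectiveSpace.toBase n _) := by
    rw [hy]
    infer_instance
  have : IsDominant y := isDominant_lift_of_isIso_restrict (j ≫ ProjectiveSpace.toBase n _) U y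
    (by rw [hy]; exact hη)
  -- As `Y` is reduced, topological density suffices.
  have : IsSchemeTheoreticallyDominant y := .of_isDominant y
  obtain ⟨v, i, hv, hyv⟩ := exists_eq_specPoint (y ≫ j ≫ ProjectiveSpace.toInt n _)
  have hv0 : v ≠ 0 := fun h ↦ by simp [h] at hv
  obtain ⟨c, f, hc, hvf, hf⟩ := exists_primitive_multiple (R := R) v hv0
  obtain rfl : v = fun k ↦ c * algebraMap R F (f k) := funext hvf
  have hfi : IsUnit (algebraMap R F (f i)) := isUnit_of_mul_isUnit_right (hv ▸ isUnit_one)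
  rw [specPoint_mul_left c _ i i hfi] at hyv
  have hf0 : f ≠ 0 := by
    rintro rfl
    simp at hfi
  obtain ⟨m, hm⟩ := exists_maximalIdeal_pow_le_span f hf0 hf fun p hp hpm ↦ by
    obtain ⟨x, hxm, hxp⟩ := SetLike.exists_of_lt
      (lt_of_le_of_ne (IsLocalRing.le_maximalIdeal hp.ne_top) hpm)
    obtain ⟨y', hy', -⟩ := exists_unique_lift_of_isIso_restrict (j ≫ ProjectiveSpace.toBase n _) U
      (Spec.map (CommRingCat.ofHom (algebraMap R (Localization.AtPrime p))))
      ((range_specMap_subset _ x hxm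
        (IsLocalization.map_units _ (⟨x, hxp⟩ : p.primeCompl))).trans hU)
    let φ : Localization.AtPrime p →+* F := IsLocalization.lift (M := p.primeCompl)
      (g := algebraMap R F) fun s ↦ by
        rw [isUnit_iff_ne_zero, map_ne_zero_iff _ (IsFractionRing.injective R F)]
        rintro h
        exact s.2 (h ▸ p.zero_mem)
    have hφ : φ.comp (algebraMap R _) = algebraMap R F := IsLocalization.lift_comp _
    -- By uniqueness of lifts, the lift over `R_p` restricts to `y` at the generic point.
    have hyy : Spec.map (CommRingCat.ofHom φ) ≫ y' = y := hyu _ (by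
      beta_reduce
      rw [Category.assoc, hy', ← Spec.map_comp, ← CommRingCat.ofHom_comp, hφ])
    exact exists_proportional_of_specPoint p f i hfi φ hφ (y' ≫ j ≫ ProjectiveSpace.toInt n _)
      (by rw [reassoc_of% hyy, hyv])
  obtain ⟨N, g, hN, hNg⟩ := exists_isUnit_matrix_mulVec_eq_coe f hm
  obtain ⟨α, hα, hαb, h⟩ := exists_specMatrix_automorphism N hN
  have hNg' : (N.map (algebraMap R F)).mulVec (fun k ↦ algebraMap R F (f k)) =
      fun k ↦ algebraMap R F (algebraMap (MvPolynomial (Fin d) K) R (g k)) := by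
    ext k
    rw [algebraMap_mvPolynomial_mvPowerSeries]
    exact (RingHom.map_mulVec (algebraMap R F) N f k).symm.trans
      (congrArg (algebraMap R F) (congrFun hNg k))
  obtain ⟨k, hk⟩ := exists_isUnit_mulVec (algebraMap F F) (N.map (algebraMap R F))
    (hN.map (algebraMap R F).mapMatrix) (fun k ↦ algebraMap R F (f k)) i hfi
  have hk' : IsUnit ((N.map (algebraMap R F)).mulVec (fun k ↦ algebraMap R F (f k)) k) := hk
  have h1 := h F (algebraMap R F) (y ≫ j) (fun k ↦ algebraMap R F (f k)) i hfi k hk'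
    (by rw [Category.assoc, hy]) (by rw [Category.assoc, hyv])
  have hk₂ := congrFun hNg' k ▸ hk'
  have : FaithfulSMul (MvPolynomial (Fin d) K) R := by
    rw [faithfulSMul_iff_algebraMap_injective, algebraMap_mvPolynomial_mvPowerSeries]
    exact MvPolynomial.coe_injective _ _
  -- The embedding `j ≫ α` has the same structure morphism as `j`, and its generic point has the
  -- polynomial coordinates `g`.
  have h2 := exists_isPullback_of_specPoint (A := MvPolynomial (Fin d) K) (j ≫ α) y
    (by rw [Category.assoc, hαb, hy]) g k hk₂
    (by
      rw [Category.assoc, ← Category.assoc y, h1]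
      congr 1)
  simpa only [Category.assoc, hαb] using h2

lemma IsProjective.comp_isIso {Y X S : Scheme.{u}} {f : Y ⟶ X} (hf : IsProjective f) (u : X ⟶ S)
    [IsIso u] : IsProjective (f ≫ u) := by
  obtain ⟨n, j, hj, rfl⟩ := hf
  have h := (ProjectiveSpace.isPullback_lift n u).isIso_fst_of_isIso
  exact ⟨n, j ≫ ProjectiveSpace.lift (ProjectiveSpace.toBase n X ≫ u) (ProjectiveSpace.toInt n X),
    inferInstance, by rw [Category.assoc, ProjectiveSpace.lift_toBase, Category.assoc]⟩

lemma FormalSpec.toAffSpace_eq (d : ℕ) (K : Type u) [Field K] :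
    FormalSpec.toAffSpace d K = Spec.map (CommRingCat.ofHom
      (algebraMap (MvPolynomial (Fin d) K) (MvPowerSeries (Fin d) K))) := by
  rw [algebraMap_mvPolynomial_mvPowerSeries]
  rfl

lemma FormalSpec.isIso_toAffSpace_zero (K : Type u) [Field K] :
    IsIso (FormalSpec.toAffSpace 0 K) := by
  have : IsIso (CommRingCat.ofHom
      (MvPolynomial.coeToMvPowerSeries.ringHom (σ := Fin 0) (R := K))) :=
    (ConcreteCategory.isIso_iff_bijective _).mpr (bijective_coe_of_isEmpty (Fin 0) K)
  exact inferInstanceAs (IsIso (Spec.map (CommRingCat.ofHom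
      (MvPolynomial.coeToMvPowerSeries.ringHom (σ := Fin 0) (R := K)))))

end Descent

end

theorem mainTheorem10 (K : Type u) [Field K] (d : ℕ) (Y : Scheme.{u})
    (f : Y ⟶ Descent.FormalSpec d K)
    (hvar : Descent.IsVarietyOver f)
    (hproj : Descent.IsProjective f)
    (hiso : IsIso (f ∣_ Descent.FormalSpec.puncturedOpen d K)) :
    Descent.IsDescendible f := by
  -- For `d = 0` the punctured spectrum is empty and the isomorphism hypothesis says nothing, but
  -- there `Y` itself descends.
  rcases eq_or_ne d 0 with rfl | hd
  · have := Descent.FormalSpec.isIso_toAffSpace_zero K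
    exact ⟨Y, f ≫ Descent.FormalSpec.toAffSpace 0 K, 𝟙 Y, hproj.comp_isIso _,
      .of_horiz_isIso ⟨by simp⟩⟩
  · obtain ⟨n, j, hj, rfl⟩ := hproj
    have := hvar.isIntegral
    obtain ⟨Ybar, k, g, hk, h⟩ := Descent.exists_isPullback_of_isIso_restrict hd K j hj
      (Descent.FormalSpec.puncturedOpen d K) subset_rfl hiso
    refine ⟨Ybar, k ≫ Descent.ProjectiveSpace.toBase n _, g, ⟨n, k, hk, rfl⟩, ?_⟩
    rw [Descent.FormalSpec.toAffSpace_eq]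
    exact h
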